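/- **Definitions.** A *convex billiard table* is a compact convex set $T\subset\mathbb R^2$ with non-empty interior. An *outward support vector* of $T$ at $q\in\partial T$ is a vector $\nu$ with $\langle x-q,\nu\rangle\le 0$ for all $x\in T$; the point $q$ is *smooth* if $T$ has exactly one outward support vector of norm $1$ at $q$. A *generalised billiard orbit* on $T$ is a sequence $(q_i)_{i\in\mathbb Z}$ in $\partial T$ with $q_{i+1}\ne q_i$ such that for every $i$ the vector $$\nu_i=\frac{q_i-q_{i-1}}{\|q_i-q_{i-1}\|}+\frac{q_i-q_{i+1}}{\|q_i-q_{i+1}\|}$$ is an outward support vector of $T$ at $q_i$. It is *closed* if $q_{i+n}=q_i$ for all $i$, for some $n\ge 2$; if $n$ is the smallest such number, the orbit $c$ is an *$n$-bounce orbit*, and its length is $\ell(c)=\sum_{i=0}^{n-1}\|q_{i+1}-q_i\|$. It is *regular* if all $q_i$ are smooth. Let $\mathcal P_3(T)$ be the set of 3-bounce generalised closed orbits on $T$, $\mathcal P_{3,\mathrm{reg}}(T)$ the set of regular ones among them, and $\mathcal P_{\min}(T)$ the set of generalised closed billiard orbits on $T$ of minimal length among all generalised closed billiard orbits on $T$.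 Let $\operatorname{width}(T)$ be the thickness of the thinnest band (region between two parallel lines) containing $T$. **Statement.** 1. Let $T$ be a convex billiard table and suppose that there is $c\in\mathcal P_3(T)$ with $\ell(c)<2\operatorname{width}(T)$. Let $T'$ be a convex billiard table and $r_1,r_2>0$ real numbers with $$r_1T\subset T'\subset r_2T\qquad\text{and}\qquad \frac{r_2}{r_1}<\frac{2\operatorname{width}(T)}{\ell(c)}.$$ Then $\mathcal P_{\min}(T')$ is non-empty and $\mathcal P_{\min}(T')\subset\mathcal P_{3,\mathrm{reg}}(T')$, i.e. every shortest generalised closed billiard orbit on $T'$ is a regular 3-bounce orbit. 2. Let $\Delta\subset\mathbb R^2$ be an equilateral triangle (with its interior) of edge length $1$, in any position. The three feet of the altitudes of $\Delta$ are the bounce points of a regular 3-bounce orbit on $\Delta$ (the Fagnano triangle), which is equilateral with edges of length $\frac12$ and so has length $\frac32<2\operatorname{width}(\Delta)=\sqrt3$. Consequently, if $T'$ is a convex billiard table and $r_1,r_2>0$ satisfy $$r_1\Delta\subset T'\subset r_2\Delta\qquad\text{and}\qquad\frac{r_2}{r_1}<\frac{2\sqrt3}{3},$$ then $\mathcal P_{\min}(T')$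 is non-empty and every element of $\mathcal P_{\min}(T')$ is a regular 3-bounce orbit. -/

import Mathlib

open scoped Pointwise

/-- The Euclidean plane. -/
abbrev Plane : Type := EuclideanSpace ℝ (Fin 2)

namespace Billiard

/-- A planar convex billiard table: a compact convex set with non-empty interior. -/
structure IsTable (T : Set Plane) : Prop where
  isCompact : IsCompact T
  convex : Convex ℝ T
  nonempty_interior : (interior T).Nonempty

/-- `ν` is an outward support vector of `T` at `q`. -/
def IsOutwardSupportVector (T : Set Plane) (q ν : Plane) : Prop :=
  ∀ x ∈ T, inner ℝ (x - q) ν ≤ 0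

/-- A boundary point is smooth if the outward support vector there is unique up to scaling,
that is, if there is exactly one outward support vector of norm one. -/
def IsSmoothPoint (T : Set Plane) (q : Plane) : Prop :=
  q ∈ frontier T ∧ ∃! ν : Plane, ‖ν‖ = 1 ∧ IsOutwardSupportVector T q ν

/-- The sum of the unit vectors pointing to `q i` from its predecessor and from its successor. -/
noncomputable def bounceVector (q : ℤ → Plane) (i : ℤ) : Plane :=
  (‖q i - q (i - 1)‖⁻¹) • (q i - q (i - 1)) + (‖q i - q (i + 1)‖⁻¹) • (q i - q (i + 1))

/-- A generalised billiard orbit on `T`. Consecutive bounce points are distinct, since the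
bounce vectors involve division by their distances. -/
structure IsOrbit (T : Set Plane) (q : ℤ → Plane) : Prop where
  mem_frontier : ∀ i, q i ∈ frontier T
  ne_succ : ∀ i, q (i + 1) ≠ q i
  support : ∀ i, IsOutwardSupportVector T (q i) (bounceVector q i)

/-- The integers `n ≥ 2` such that `q` is `n`-periodic. -/
def periods (q : ℤ → Plane) : Set ℕ :=
  {n : ℕ | 2 ≤ n ∧ ∀ i : ℤ, q (i + n) = q i}

/-- The generalised closed billiard orbits on `T`. -/
def closedOrbits (T : Set Plane) : Set (ℤ → Plane) :=
  {q | IsOrbit T q ∧ (periods q).Nonempty}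

/-- The smallest element of `periods q` (used for closed orbits only). -/
noncomputable def period (q : ℤ → Plane) : ℕ := sInf (periods q)

/-- The `n`-bounce generalised closed billiard orbits on `T`. -/
def bounceOrbits (n : ℕ) (T : Set Plane) : Set (ℤ → Plane) :=
  {q | q ∈ closedOrbits T ∧ period q = n}

/-- The regular `n`-bounce orbits on `T`: all bounce points are smooth. -/
def regularBounceOrbits (n : ℕ) (T : Set Plane) : Set (ℤ → Plane) :=
  {q | q ∈ bounceOrbits n T ∧ ∀ i, IsSmoothPoint T (q i)}

/-- The length of a closed orbit. -/
noncomputable def length (q : ℤ → Plane) : ℝ :=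
  ∑ i ∈ Finset.range (period q), ‖q ((i : ℤ) + 1) - q (i : ℤ)‖

/-- The generalised closed billiard orbits on `T` of minimal length. -/
def shortestOrbits (T : Set Plane) : Set (ℤ → Plane) :=
  {q | q ∈ closedOrbits T ∧ ∀ p ∈ closedOrbits T, length q ≤ length p}

/-- The thickness of the thinnest band containing `T`. -/
noncomputable def width (T : Set Plane) : ℝ :=
  sInf {d : ℝ | ∃ u : Plane, ‖u‖ = 1 ∧ ∃ a : ℝ,
    ∀ x ∈ T, a ≤ inner ℝ u x ∧ inner ℝ u x ≤ a + d}

end Billiard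

/-! Shortest closed orbits are found among the blocked configurations, those that cannot be
translated into the interior of the table. By Hahn–Banach, being blocked amounts to carrying normals
that sum to zero and whose linear functional is maximised over the table at the configuration's
value.

The bounce vectors of a closed orbit are such normals, so its bounce points are blocked. By Helly's
theorem in the plane, three of them already are, and by the triangle inequality their perimeter is
at most the length of the orbit (`exists_blocked_subtriple`, `perimeter_subtriple_le`).

Conversely, a blocked pair is at least as far apart as the table is wide. If some blocked triple has
perimeter below twice the width, a shortest one is therefore a genuine triangle. Minimality and
homogeneity force its certificate to be, up to a positive factor, the family of its billiard normals
(`IsMinimalBlocked.exists_triangleNormal_eq`), so a translate of it is an orbit. Uniqueness of the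
certificate leaves one supporting direction at each vertex, whence regularity.

In a shortest orbit the blocked triple has the full length. A further bounce point would lie inside
an edge and on the frontier, which the uniqueness of supports excludes; hence there are exactly
three bounces. The assumptions on scalings transport the blocked triple and the width bound from $T$
to $T'$. -/

namespace Billiard

/-! ### Blocked configurations and their certificates. -/

/-- The configuration `x` cannot be translated into the interior of `T`. -/
def Blocked {ι : Type*} (T : Set Plane) (x : ι → Plane) : Prop :=
  ∀ t : Plane, ∃ i, x i + t ∉ interior T

/-- A family of normals, summing to zero, that certifies that `x` cannot be translated into the
interior of `T`. -/
structure Certificate {ι : Type*} [Fintype ι] (T : Set Plane) (x n : ι → Plane) : Prop where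
  ne_zero : n ≠ 0
  sum_eq_zero : ∑ i, n i = 0
  le : ∀ y : ι → Plane, (∀ i, y i ∈ T) → ∑ i, inner ℝ (n i) (y i) ≤ ∑ i, inner ℝ (n i) (x i)

section Certificate

variable {ι : Type*} [Fintype ι] {T : Set Plane} {x n : ι → Plane}

theorem sum_norm_sq_pos (hn : n ≠ 0) : 0 < ∑ i, ‖n i‖ ^ 2 := by
  obtain ⟨j, hj⟩ := Function.ne_iff.1 hn
  exact Finset.sum_pos' (fun i _ => by positivity)
    ⟨j, Finset.mem_univ _, by have := norm_pos_iff.2 hj; positivity⟩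

/-- A nonzero linear functional on configurations does not attain its supremum over `T` at a
configuration in the interior. -/
theorem Certificate.lt_of_mem_interior (h : Certificate T x n) {y : ι → Plane}
    (hy : ∀ i, y i ∈ interior T) : ∑ i, inner ℝ (n i) (y i) < ∑ i, inner ℝ (n i) (x i) := by
  have hc : Continuous fun ε : ℝ => y + ε • n := by fun_prop
  have ho : IsOpen (Set.univ.pi fun _ : ι => interior T) :=
    isOpen_set_pi Set.finite_univ fun _ _ => isOpen_interior
  have h0 : (fun ε : ℝ => y + ε • n) ⁻¹' (Set.univ.pi fun _ : ι => interior T) ∈ nhds (0 : ℝ) :=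
    (ho.preimage hc).mem_nhds (by simpa using hy)
  obtain ⟨ε, hε, hball⟩ := Metric.mem_nhds_iff.1 h0
  have hm := hball (show ε / 2 ∈ Metric.ball (0 : ℝ) ε by
    rw [Metric.mem_ball, Real.dist_eq, sub_zero, abs_of_pos (by positivity)]; linarith)
  have hm' : ∀ i, y i + (ε / 2) • n i ∈ T := fun i => interior_subset (by simpa using hm i trivial)
  have := h.le _ hm'
  simp only [inner_add_right, inner_smul_right, real_inner_self_eq_norm_sq,
    Finset.sum_add_distrib, ← Finset.mul_sum] at this
  nlinarith [sum_norm_sq_pos h.ne_zero]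

theorem Certificate.sum_inner_add (h : Certificate T x n) (y : ι → Plane) (t : Plane) :
    ∑ i, inner ℝ (n i) (y i + t) = ∑ i, inner ℝ (n i) (y i) := by
  simp only [inner_add_right, Finset.sum_add_distrib]
  rw [← sum_inner, h.sum_eq_zero, inner_zero_left, add_zero]

/-- Normals with zero sum make the functional invariant under translation, whereas it is strictly
smaller on the interior. -/
theorem Certificate.blocked (h : Certificate T x n) : Blocked T x := by
  intro t
  by_contra! hc
  have := h.lt_of_mem_interior hc
  rw [h.sum_inner_add] at this
  exact lt_irrefl _ this

theorem Certificate.pos (h : Certificate T x n) (hT : (interior T).Nonempty) :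
    0 < ∑ i, inner ℝ (n i) (x i) := by
  obtain ⟨p, hp⟩ := hT
  have := h.lt_of_mem_interior (y := fun _ => p) fun _ => hp
  rwa [← sum_inner, h.sum_eq_zero, inner_zero_left] at this

/-- A certificate constrains the configuration only through one number. This allows configurations
outside `T`, in particular rescaled and translated ones. -/
theorem Certificate.of_sum_eq (h : Certificate T x n) {y : ι → Plane}
    (hy : ∑ i, inner ℝ (n i) (x i) ≤ ∑ i, inner ℝ (n i) (y i)) : Certificate T y n :=
  ⟨h.ne_zero, h.sum_eq_zero, fun z hz => (h.le z hz).trans hy⟩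

theorem Certificate.smul (h : Certificate T x n) {c : ℝ} (hc : 0 < c) :
    Certificate T x (c • n) := by
  refine ⟨smul_ne_zero hc.ne' h.ne_zero, ?_, fun y hy => ?_⟩
  · simp [← Finset.smul_sum, h.sum_eq_zero]
  · simp only [Pi.smul_apply, inner_smul_left, ← Finset.mul_sum]
    exact mul_le_mul_of_nonneg_left (h.le y hy) hc.le

theorem Certificate.isOutwardSupportVector (h : Certificate T x n) (hx : ∀ i, x i ∈ T) (i : ι) :
    IsOutwardSupportVector T (x i) (n i) := by
  classical
  intro z hz
  have := h.le (Function.update x i z) fun j => by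
    rcases eq_or_ne j i with rfl | hj
    · simpa
    · simpa [hj] using hx j
  rw [← sub_nonneg, ← Finset.sum_sub_distrib, Finset.sum_eq_single i] at this
  · rw [real_inner_comm, inner_sub_right]
    simpa using this
  · intro j _ hj
    simp [hj]
  · simp

theorem certificate_of_isOutwardSupportVector (hn : n ≠ 0) (hsum : ∑ i, n i = 0)
    (h : ∀ i, IsOutwardSupportVector T (x i) (n i)) : Certificate T x n := by
  refine ⟨hn, hsum, fun y hy => Finset.sum_le_sum fun i _ => ?_⟩
  have := h i (y i) (hy i)
  rw [real_inner_comm, inner_sub_right] at this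
  linarith

/-- Hahn–Banach: a configuration that cannot be translated into the interior of a table has a
certificate. -/
theorem Blocked.exists_certificate (hT : IsTable T) (hx : Blocked T x) :
    ∃ n, Certificate T x n := by
  classical
  have hconv : Convex ℝ (Set.univ.pi fun _ : ι => interior T) :=
    convex_pi fun _ _ => hT.convex.interior
  have ho : IsOpen (Set.univ.pi fun _ : ι => interior T) :=
    isOpen_set_pi Set.finite_univ fun _ _ => isOpen_interior
  have hline : Convex ℝ (Set.range fun t : Plane => fun i => x i + t) := by
    rintro _ ⟨t, rfl⟩ _ ⟨s, rfl⟩ a b _ _ hab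
    refine ⟨a • t + b • s, ?_⟩
    ext1 i
    simp only [Pi.add_apply, Pi.smul_apply, smul_add]
    have : x i = a • x i + b • x i := by rw [← add_smul, hab, one_smul]
    nth_rewrite 1 [this]
    abel
  have hdisj : Disjoint (Set.univ.pi fun _ : ι => interior T)
      (Set.range fun t : Plane => fun i => x i + t) := by
    rw [Set.disjoint_left]
    rintro _ hy ⟨t, rfl⟩
    obtain ⟨i, hi⟩ := hx t
    exact hi (hy i trivial)
  obtain ⟨f, u, hfu, huf⟩ := geometric_hahn_banach_open hconv ho hline hdisj
  obtain ⟨n, hn⟩ : ∃ n : ι → Plane, ∀ y, f y = ∑ i, inner ℝ (n i) (y i) := by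
    refine ⟨fun i => (InnerProductSpace.toDual ℝ Plane).symm
      (f.comp (ContinuousLinearMap.single ℝ (fun _ : ι => Plane) i)), fun y => ?_⟩
    simp only [InnerProductSpace.toDual_symm_apply, ContinuousLinearMap.comp_apply,
      ContinuousLinearMap.single_apply]
    rw [← map_sum, Finset.univ_sum_single]
  have hlow : ∀ t : Plane, u ≤ ∑ i, inner ℝ (n i) (x i) + inner ℝ (∑ i, n i) t := by
    intro t
    have := huf _ ⟨t, rfl⟩
    rw [hn] at this
    simpa only [inner_add_right, Finset.sum_add_distrib, ← sum_inner] using this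
  obtain ⟨p, hp⟩ := hT.nonempty_interior
  have hup := hfu (fun _ => p) fun _ _ => hp
  -- A linear functional of the translation that is bounded below must vanish. The chosen
  -- translation would give the value `u - 1`.
  have hsum : ∑ i, n i = 0 := by
    by_contra hne
    have hpos : 0 < ‖∑ i, n i‖ ^ 2 := by have := norm_pos_iff.2 hne; positivity
    have := hlow ((-(∑ i, inner ℝ (n i) (x i) - u + 1) / ‖∑ i, n i‖ ^ 2) • ∑ i, n i)
    rw [inner_smul_right, real_inner_self_eq_norm_sq, div_mul_cancel₀ _ hpos.ne'] at this
    linarith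
  have hlow0 : u ≤ ∑ i, inner ℝ (n i) (x i) := by simpa using hlow 0
  refine ⟨n, ?_, hsum, fun y hy => ?_⟩
  · rintro rfl
    rw [hn] at hup
    simp at hup hlow0
    linarith
  -- The separation only sees the interior; a convex set with interior points lies in the closure of
  -- its interior.
  · have hcl : y ∈ closure (Set.univ.pi fun _ : ι => interior T) := by
      rw [closure_pi_set]
      intro i _
      rw [hT.convex.closure_interior_eq_closure_of_nonempty_interior hT.nonempty_interior]
      exact subset_closure (hy i)
    have : closure (Set.univ.pi fun _ : ι => interior T) ⊆ {z | f z ≤ u} :=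
      closure_minimal (fun z hz => (hfu z hz).le) (isClosed_le f.continuous continuous_const)
    rw [← hn]
    exact (this hcl).trans hlow0

end Certificate

theorem Blocked.add_const {ι : Type*} {T : Set Plane} {x : ι → Plane} (hx : Blocked T x)
    (t : Plane) : Blocked T fun i => x i + t := by
  intro s
  obtain ⟨i, hi⟩ := hx (t + s)
  exact ⟨i, by rwa [add_assoc]⟩

theorem isClosed_setOf_blocked {ι : Type*} [Finite ι] (T : Set Plane) :
    IsClosed {x : ι → Plane | Blocked T x} := by
  have : {x : ι → Plane | Blocked T x}ᶜ =
      ⋃ t : Plane, {x | ∀ i, x i + t ∈ interior T} := by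
    ext x
    simp [Blocked]
  rw [← isOpen_compl_iff, this]
  refine isOpen_iUnion fun t => ?_
  simp only [Set.ofPred_forall]
  exact isOpen_iInter_of_finite fun i =>
    isOpen_interior.preimage ((continuous_apply i).add continuous_const)

/-! ### Blocked pairs and the width. -/

theorem bddBelow_bands (T : Set Plane) (hT : T.Nonempty) : BddBelow {d : ℝ | ∃ u : Plane, ‖u‖ = 1 ∧
    ∃ a : ℝ, ∀ x ∈ T, a ≤ inner ℝ u x ∧ inner ℝ u x ≤ a + d} := by
  refine ⟨0, ?_⟩
  rintro d ⟨u, -, a, h⟩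
  obtain ⟨p, hp⟩ := hT
  linarith [(h p hp).1, (h p hp).2]

theorem IsTable.nonempty {T : Set Plane} (hT : IsTable T) : T.Nonempty :=
  hT.nonempty_interior.mono interior_subset

/-- A segment that cannot be translated into the interior of a table is at least as long as the
table is wide. -/
theorem Blocked.width_le {T : Set Plane} (hT : IsTable T) {x : Fin 2 → Plane}
    (hx : Blocked T x) : width T ≤ ‖x 0 - x 1‖ := by
  obtain ⟨n, hn⟩ := hx.exists_certificate hT
  have h1 : n 1 = -n 0 := by
    have := hn.sum_eq_zero
    rw [Fin.sum_univ_two] at this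
    exact eq_neg_of_add_eq_zero_right this
  have h0 : n 0 ≠ 0 := by
    intro h0
    refine hn.ne_zero (funext fun i => ?_)
    fin_cases i <;> simp [h1, h0]
  have hpos := norm_pos_iff.2 h0
  have key : ∀ y ∈ T, ∀ z ∈ T, inner ℝ (n 0) y - inner ℝ (n 0) z ≤ ‖n 0‖ * ‖x 0 - x 1‖ := by
    intro y hy z hz
    have := hn.le ![y, z] (by intro i; fin_cases i <;> simpa)
    simp only [Fin.sum_univ_two, h1, inner_neg_left, Matrix.cons_val_zero,
      Matrix.cons_val_one] at this
    have h2 := real_inner_le_norm (n 0) (x 0 - x 1)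
    rw [inner_sub_right] at h2
    linarith
  obtain ⟨z, hz, hmin⟩ := hT.isCompact.exists_isMinOn hT.nonempty
    (f := fun y => inner ℝ (n 0) y) (by fun_prop)
  refine csInf_le (bddBelow_bands T hT.nonempty) ⟨‖n 0‖⁻¹ • n 0, ?_, ‖n 0‖⁻¹ * inner ℝ (n 0) z,
    fun y hy => ?_⟩
  · rw [norm_smul, norm_inv, norm_norm, inv_mul_cancel₀ hpos.ne']
  · have hinv : 0 < ‖n 0‖⁻¹ := by positivity
    rw [inner_smul_left, RCLike.conj_to_real]
    refine ⟨mul_le_mul_of_nonneg_left (hmin hy) hinv.le, ?_⟩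
    have := mul_le_mul_of_nonneg_left (key y hy z hz) hinv.le
    rw [← mul_assoc, inv_mul_cancel₀ hpos.ne', one_mul, mul_sub] at this
    linarith

/-! ### Triangles indexed by `ZMod 3`: perimeter and billiard normals. -/

theorem sum_zmod_three {M : Type*} [AddCommMonoid M] (f : ZMod 3 → M) (i : ZMod 3) :
    ∑ j, f j = f i + f (i + 1) + f (i + 2) := by
  rw [← Equiv.sum_comp (Equiv.addLeft i)]
  have := Fin.sum_univ_three (fun j : Fin 3 => f (i + (show ZMod 3 from j)))
  refine this.trans ?_
  congr 3
  exact add_zero i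

theorem zmod_three_sub_one : ∀ i : ZMod 3, i - 1 = i + 2 := by decide

theorem zmod_three_add_one_add_one : ∀ i : ZMod 3, i + 1 + 1 = i + 2 := by decide

theorem zmod_three_add_two_add_one : ∀ i : ZMod 3, i + 2 + 1 = i := by decide

theorem zmod_three_add_one_ne : ∀ i : ZMod 3, i + 1 ≠ i := by decide

theorem zmod_three_add_two_ne : ∀ i : ZMod 3, i + 2 ≠ i := by decide

theorem zmod_three_add_two_ne_add_one : ∀ i : ZMod 3, i + 2 ≠ i + 1 := by decide

theorem zmod_three_eq_or : ∀ i j : ZMod 3, j = i ∨ j = i + 1 ∨ j = i + 2 := by decide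

/-- The length of the closed polygon through three points. -/
noncomputable def perimeter (x : ZMod 3 → Plane) : ℝ :=
  ∑ i, ‖x (i + 1) - x i‖

theorem perimeter_eq (x : ZMod 3 → Plane) (i : ZMod 3) :
    perimeter x = ‖x (i + 1) - x i‖ + ‖x (i + 2) - x (i + 1)‖ + ‖x i - x (i + 2)‖ := by
  rw [perimeter, sum_zmod_three _ i, zmod_three_add_one_add_one, zmod_three_add_two_add_one]

theorem perimeter_nonneg (x : ZMod 3 → Plane) : 0 ≤ perimeter x :=
  Finset.sum_nonneg fun _ _ => norm_nonneg _

theorem perimeter_add_const (x : ZMod 3 → Plane) (t : Plane) :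
    perimeter (fun i => x i + t) = perimeter x := by
  simp [perimeter]

theorem perimeter_smul {c : ℝ} (hc : 0 ≤ c) (x : ZMod 3 → Plane) :
    perimeter (c • x) = c * perimeter x := by
  simp only [perimeter, Pi.smul_apply, ← smul_sub, norm_smul, Real.norm_of_nonneg hc,
    Finset.mul_sum]

theorem norm_sub_le_perimeter (x : ZMod 3 → Plane) (i j : ZMod 3) :
    2 * ‖x i - x j‖ ≤ perimeter x := by
  have h1 : ∀ i, 2 * ‖x (i + 1) - x (i + 2)‖ ≤ perimeter x := by
    intro i
    rw [perimeter_eq x i, norm_sub_rev (x (i + 2))]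
    have := norm_sub_le_norm_sub_add_norm_sub (x (i + 1)) (x i) (x (i + 2))
    linarith
  have h2 : ∀ i j : ZMod 3, i = j ∨ (∃ k, k + 1 = i ∧ k + 2 = j) ∨ ∃ k, k + 1 = j ∧ k + 2 = i := by
    decide
  rcases h2 i j with rfl | ⟨k, rfl, rfl⟩ | ⟨k, rfl, rfl⟩
  · simpa using perimeter_nonneg x
  · exact h1 k
  · rw [norm_sub_rev]
    exact h1 k

/-- The sum of the unit vectors pointing to `x i` from the two other vertices. -/
noncomputable def triangleNormal (x : ZMod 3 → Plane) (i : ZMod 3) : Plane :=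
  (‖x i - x (i - 1)‖⁻¹) • (x i - x (i - 1)) + (‖x i - x (i + 1)‖⁻¹) • (x i - x (i + 1))

/-- The unit vector of an edge. -/
noncomputable def edgeDirection (x : ZMod 3 → Plane) (i : ZMod 3) : Plane :=
  (‖x (i + 1) - x i‖⁻¹) • (x (i + 1) - x i)

theorem triangleNormal_eq (x : ZMod 3 → Plane) (i : ZMod 3) :
    triangleNormal x i = edgeDirection x (i - 1) - edgeDirection x i := by
  rw [triangleNormal, edgeDirection, edgeDirection, sub_add_cancel,
    ← neg_sub (x (i + 1)) (x i), smul_neg, norm_neg, ← sub_eq_add_neg]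

theorem sum_triangleNormal (x : ZMod 3 → Plane) : ∑ i, triangleNormal x i = 0 := by
  simp only [triangleNormal_eq, Finset.sum_sub_distrib]
  rw [sub_eq_zero]
  exact Equiv.sum_comp (Equiv.subRight (1 : ZMod 3)) (edgeDirection x)

theorem inner_inv_norm_smul_self (v : Plane) : inner ℝ ((‖v‖⁻¹) • v) v = ‖v‖ := by
  rcases eq_or_ne v 0 with rfl | hv
  · simp
  · have := norm_pos_iff.2 hv
    rw [inner_smul_left, RCLike.conj_to_real, real_inner_self_eq_norm_sq]
    field_simp

/-- No vertex lies on the opposite edge; in particular, the vertices are distinct. -/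
def Nondegenerate (x : ZMod 3 → Plane) : Prop :=
  ∀ i, x i ∉ segment ℝ (x (i + 1)) (x (i + 2))

theorem Nondegenerate.ne_succ {x : ZMod 3 → Plane} (hx : Nondegenerate x) (i : ZMod 3) :
    x (i + 1) ≠ x i := fun h => hx i (h ▸ left_mem_segment _ _ _)

theorem Nondegenerate.ne_pred {x : ZMod 3 → Plane} (hx : Nondegenerate x) (i : ZMod 3) :
    x (i - 1) ≠ x i := fun h => by
  rw [zmod_three_sub_one] at h
  exact hx i (h ▸ right_mem_segment _ _ _)

theorem Nondegenerate.norm_edgeDirection {x : ZMod 3 → Plane} (hx : Nondegenerate x) (i : ZMod 3) :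
    ‖edgeDirection x i‖ = 1 := by
  have := norm_pos_iff.2 (sub_ne_zero.2 (hx.ne_succ i))
  rw [edgeDirection, norm_smul, norm_inv, norm_norm, inv_mul_cancel₀ this.ne']

/-- Opposite unit vectors towards the two neighbours would place the vertex between them. -/
theorem Nondegenerate.triangleNormal_ne_zero {x : ZMod 3 → Plane} (hx : Nondegenerate x)
    (i : ZMod 3) : triangleNormal x i ≠ 0 := by
  intro h
  rw [triangleNormal] at h
  have hα : 0 < ‖x i - x (i - 1)‖⁻¹ :=
    inv_pos.2 (norm_pos_iff.2 (sub_ne_zero.2 (hx.ne_pred i).symm))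
  have hβ : 0 < ‖x i - x (i + 1)‖⁻¹ :=
    inv_pos.2 (norm_pos_iff.2 (sub_ne_zero.2 (hx.ne_succ i).symm))
  set α := ‖x i - x (i - 1)‖⁻¹
  set β := ‖x i - x (i + 1)‖⁻¹
  refine hx i ⟨β / (α + β), α / (α + β), by positivity, by positivity, by field_simp; ring, ?_⟩
  rw [zmod_three_sub_one] at h
  have h' : β • x (i + 1) + α • x (i + 2) = (α + β) • x i := by
    rw [smul_sub, smul_sub] at h
    rw [add_smul, ← sub_eq_zero, ← neg_eq_zero, ← h]
    abel
  have hne : α + β ≠ 0 := by positivity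
  rw [div_eq_inv_mul, div_eq_inv_mul, mul_smul, mul_smul, ← smul_add, h', smul_smul,
    inv_mul_cancel₀ hne, one_smul]

/-- Two normals of a nondegenerate triangle span the plane. -/
theorem Nondegenerate.exists_eq_smul_add_smul {x : ZMod 3 → Plane} (hx : Nondegenerate x)
    (i : ZMod 3) (m : Plane) :
    ∃ β γ : ℝ, m = β • triangleNormal x (i + 1) + γ • triangleNormal x (i + 2) := by
  -- If two normals were parallel, the three unit edge directions would be collinear points of the
  -- unit circle. A line meets the circle at most twice, so two directions agree and some normal
  -- vanishes: `s = 0` or `s = -1`.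
  have hli : LinearIndependent ℝ ![triangleNormal x (i + 1), triangleNormal x (i + 2)] := by
    rw [LinearIndependent.pair_iff' (hx.triangleNormal_ne_zero _)]
    intro s hs
    have hu := triangleNormal_eq x (i + 1)
    have hw := triangleNormal_eq x (i + 2)
    rw [add_sub_cancel_right] at hu
    have e : i + 2 - 1 = i + 1 := by ring
    rw [e, ← hs] at hw
    have hν := norm_pos_iff.2 (hx.triangleNormal_ne_zero (i + 1))
    set ν := triangleNormal x (i + 1)
    have hu' : edgeDirection x i = edgeDirection x (i + 1) + ν := by rw [hu]; abel
    have hw' : edgeDirection x (i + 2) = edgeDirection x (i + 1) - s • ν := by rw [hw]; abel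
    have nu := hx.norm_edgeDirection i
    have nv := hx.norm_edgeDirection (i + 1)
    have nw := hx.norm_edgeDirection (i + 2)
    have su := norm_add_sq_real (edgeDirection x (i + 1)) ν
    have sw := norm_sub_sq_real (edgeDirection x (i + 1)) (s • ν)
    rw [← hu', nu, nv] at su
    rw [← hw', nw, nv, inner_smul_right, norm_smul, mul_pow, Real.norm_eq_abs, sq_abs] at sw
    have hs0 : s * (s + 1) * ‖ν‖ ^ 2 = 0 := by linear_combination -s * su - sw
    rcases mul_eq_zero.1 hs0 with h | h
    · rcases mul_eq_zero.1 h with h | h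
      · rw [h, zero_smul] at hs
        exact hx.triangleNormal_ne_zero _ hs.symm
      · have hsum := sum_triangleNormal x
        rw [sum_zmod_three _ i, ← hs, show s = -1 by linarith, neg_one_smul,
          add_neg_cancel_right] at hsum
        exact hx.triangleNormal_ne_zero _ hsum
    · exact hν.ne' (pow_eq_zero_iff two_ne_zero |>.1 h)
  have hspan := hli.span_eq_top_of_card_eq_finrank (by simp)
  have hm : m ∈ Submodule.span ℝ
      (Set.range ![triangleNormal x (i + 1), triangleNormal x (i + 2)]) :=
    hspan ▸ Submodule.mem_top
  rw [Matrix.range_cons, Matrix.range_cons, Matrix.range_empty, Set.union_empty,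
    Set.singleton_union, Submodule.mem_span_pair] at hm
  obtain ⟨β, γ, h⟩ := hm
  exact ⟨β, γ, h.symm⟩

/-- If a vertex lay between the others, convexity of the interior would make those two a blocked
pair, and the perimeter would be at least twice the width. -/
theorem Blocked.nondegenerate {T : Set Plane} (hT : IsTable T) {x : ZMod 3 → Plane}
    (hx : Blocked T x) (hlt : perimeter x < 2 * width T) : Nondegenerate x := by
  intro i hi
  have hb : Blocked T ![x (i + 1), x (i + 2)] := by
    intro t
    by_contra! hc
    have h0 : x (i + 1) + t ∈ interior T := hc 0
    have h1 : x (i + 2) + t ∈ interior T := hc 1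
    obtain ⟨j, hj⟩ := hx t
    rcases zmod_three_eq_or i j with rfl | rfl | rfl
    · refine hj (hT.convex.interior.segment_subset h0 h1 ?_)
      rw [add_comm _ t, add_comm _ t, add_comm _ t]
      exact (mem_segment_translate ℝ t).2 hi
    · exact hj h0
    · exact hj h1
  have := hb.width_le hT
  have h3 := norm_sub_le_perimeter x (i + 1) (i + 2)
  simp only [Matrix.cons_val_zero, Matrix.cons_val_one] at this
  linarith

/-! ### Shortest blocked triples: existence, normals and smoothness. -/

/-- A shortest triple among those that cannot be translated into the interior of `T`. -/
structure IsMinimalBlocked (T : Set Plane) (x : ZMod 3 → Plane) : Prop where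
  blocked : Blocked T x
  le : ∀ y : ZMod 3 → Plane, Blocked T y → perimeter x ≤ perimeter y

theorem continuous_perimeter : Continuous perimeter := by
  unfold perimeter
  fun_prop

/-- Translating so that `x 0 = 0` and bounding the perimeter leaves a compact set of competitors. -/
theorem exists_isMinimalBlocked {T : Set Plane} {y : ZMod 3 → Plane} (hy : Blocked T y) :
    ∃ x, IsMinimalBlocked T x := by
  set K : Set (ZMod 3 → Plane) := {x | Blocked T x} ∩
    ({x | x 0 = 0} ∩ {x | perimeter x ≤ perimeter y})
  have hcl : IsClosed K := (isClosed_setOf_blocked T).inter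
    ((isClosed_eq (continuous_apply 0) continuous_const).inter
      (isClosed_le continuous_perimeter continuous_const))
  have hbd : Bornology.IsBounded K := by
    refine (Metric.isBounded_closedBall (x := (0 : ZMod 3 → Plane)) (r := perimeter y)).subset ?_
    rintro x ⟨-, h0, hx⟩
    rw [mem_closedBall_zero_iff, pi_norm_le_iff_of_nonneg (perimeter_nonneg y)]
    intro i
    have h1 := norm_sub_le_perimeter x i 0
    rw [show x 0 = 0 from h0, sub_zero] at h1
    have h2 : perimeter x ≤ perimeter y := hx
    linarith [norm_nonneg (x i)]
  have hmem : ∀ z, Blocked T z → perimeter z ≤ perimeter y → (fun i => z i + -z 0) ∈ K :=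
    fun z hz hle => ⟨hz.add_const _, add_neg_cancel _, by
      rw [Set.mem_ofPred_eq, perimeter_add_const]; exact hle⟩
  obtain ⟨x, hx, hmin⟩ := (Metric.isCompact_of_isClosed_isBounded hcl hbd).exists_isMinOn
    ⟨_, hmem y hy le_rfl⟩ continuous_perimeter.continuousOn
  refine ⟨x, hx.1, fun z hz => ?_⟩
  rcases le_total (perimeter z) (perimeter y) with h | h
  · have := hmin (hmem z hz h)
    rwa [Set.mem_ofPred_eq, perimeter_add_const] at this
  · exact (show perimeter x ≤ perimeter y from hx.2.2).trans h

theorem hasDerivAt_norm_add_smul {a : Plane} (ha : a ≠ 0) (v : Plane) :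
    HasDerivAt (fun s : ℝ => ‖a + s • v‖) (inner ℝ ((‖a‖⁻¹) • a) v) 0 := by
  have h1 : HasDerivAt (fun s : ℝ => a + s • v) v 0 := by
    simpa using ((hasDerivAt_id (0 : ℝ)).smul_const v).const_add a
  have h2 := h1.norm_sq.sqrt (by simpa using ha)
  simp only [Real.sqrt_sq (norm_nonneg _)] at h2
  convert h2 using 1
  have := norm_pos_iff.2 ha
  simp only [zero_smul, add_zero, inner_smul_left, RCLike.conj_to_real]
  field_simp

/-- The first-order condition for minimising a sum of two distances minus a linear functional. -/
theorem smul_add_smul_eq_of_forall_le {a p s n : Plane} {C : ℝ} (hp : p ≠ a) (hs : s ≠ a)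
    (h : ∀ z, C * (‖a - p‖ + ‖a - s‖) - inner ℝ n a ≤ C * (‖z - p‖ + ‖z - s‖) - inner ℝ n z) :
    C • ((‖a - p‖⁻¹) • (a - p) + (‖a - s‖⁻¹) • (a - s)) = n := by
  refine ext_inner_right ℝ fun v => ?_
  have h1 := hasDerivAt_norm_add_smul (sub_ne_zero.2 hp.symm) v
  have h2 := hasDerivAt_norm_add_smul (sub_ne_zero.2 hs.symm) v
  have h3 : HasDerivAt (fun r : ℝ => inner ℝ n a + r * inner ℝ n v) (inner ℝ n v) 0 := by
    simpa using ((hasDerivAt_id (0 : ℝ)).mul_const (inner ℝ n v)).const_add (inner ℝ n a)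
  have h4 := ((h1.add h2).const_mul C).sub h3
  have hmin : IsLocalMin (fun r : ℝ => C * (‖a - p + r • v‖ + ‖a - s + r • v‖) -
      (inner ℝ n a + r * inner ℝ n v)) 0 := by
    refine Filter.Eventually.of_forall fun r => ?_
    have := h (a + r • v)
    rw [inner_add_right, inner_smul_right, add_sub_right_comm, add_sub_right_comm] at this
    simpa using this
  have := hmin.hasDerivAt_eq_zero h4
  rw [inner_smul_left, inner_add_left, RCLike.conj_to_real]
  linarith

theorem perimeter_update (x : ZMod 3 → Plane) (i : ZMod 3) (z : Plane) :
    perimeter (Function.update x i z) =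
      ‖z - x (i - 1)‖ + ‖z - x (i + 1)‖ + ‖x (i + 2) - x (i + 1)‖ := by
  rw [perimeter_eq _ i, Function.update_self, Function.update_of_ne (zmod_three_add_one_ne i),
    Function.update_of_ne (zmod_three_add_two_ne i), zmod_three_sub_one, norm_sub_rev (x (i + 1)) z]
  ring

/-- Certificates of a shortest blocked triple are unique up to scaling. -/
theorem IsMinimalBlocked.exists_triangleNormal_eq {T : Set Plane} (hT : IsTable T)
    {x n : ZMod 3 → Plane} (hx : IsMinimalBlocked T x) (hnd : Nondegenerate x)
    (hn : Certificate T x n) : ∃ κ : ℝ, 0 < κ ∧ triangleNormal x = κ • n := by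
  have hΦ := hn.pos hT.nonempty_interior
  have hlam : 0 < perimeter x := by
    have h1 := norm_sub_le_perimeter x (0 + 1) 0
    have h2 := norm_pos_iff.2 (sub_ne_zero.2 (hnd.ne_succ 0))
    linarith
  set Φ := ∑ i, inner ℝ (n i) (x i) with hΦdef
  -- Any `y` with positive functional value can be rescaled to the value `Φ`, where it is blocked;
  -- minimality of `x` then gives a homogeneous inequality, with equality at `y = x`.
  have key : ∀ y : ZMod 3 → Plane,
      perimeter x * ∑ i, inner ℝ (n i) (y i) ≤ Φ * perimeter y := by
    intro y
    rcases le_or_gt (∑ i, inner ℝ (n i) (y i)) 0 with h | h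
    · exact (mul_nonpos_of_nonneg_of_nonpos hlam.le h).trans
        (mul_nonneg hΦ.le (perimeter_nonneg y))
    · set ψ := ∑ i, inner ℝ (n i) (y i)
      have hc : Certificate T ((Φ / ψ) • y) n := hn.of_sum_eq (by
        simp only [Pi.smul_apply, inner_smul_right, ← Finset.mul_sum]
        rw [div_mul_cancel₀ _ h.ne'])
      have := hx.le _ hc.blocked
      rw [perimeter_smul (by positivity)] at this
      calc perimeter x * ψ ≤ Φ / ψ * perimeter y * ψ := by gcongr
        _ = Φ * perimeter y := by field_simp
  refine ⟨perimeter x / Φ, by positivity, funext fun i => ?_⟩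
  -- With only vertex `i` moving, equality at `x` is a minimum, and the first-order condition
  -- identifies the normal there.
  have hfo := smul_add_smul_eq_of_forall_le (C := Φ) (n := perimeter x • n i)
    (hnd.ne_pred i) (hnd.ne_succ i) fun z => ?_
  · rw [Pi.smul_apply, triangleNormal, div_eq_inv_mul, mul_smul, ← hfo, smul_smul,
      inv_mul_cancel₀ hΦ.ne', one_smul]
  · have hk := key (Function.update x i z)
    rw [perimeter_update] at hk
    have hper := perimeter_update x i (x i)
    rw [Function.update_eq_self] at hper
    have hsum : ∑ j, inner ℝ (n j) (Function.update x i z j) =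
        Φ + inner ℝ (n i) z - inner ℝ (n i) (x i) := by
      rw [hΦdef, sum_zmod_three _ i, sum_zmod_three _ i, Function.update_self,
        Function.update_of_ne (zmod_three_add_one_ne i),
        Function.update_of_ne (zmod_three_add_two_ne i)]
      ring
    rw [hsum] at hk
    simp only [inner_smul_left, RCLike.conj_to_real]
    nlinarith [hk, congrArg (Φ * ·) hper]

/-- A shortest blocked triple can be translated into the table. -/
theorem IsMinimalBlocked.exists_translate {T : Set Plane} (hT : IsTable T)
    {x : ZMod 3 → Plane} (hx : IsMinimalBlocked T x) (hpos : 0 < perimeter x) :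
    ∃ t : Plane, ∀ i, x i + t ∈ T := by
  set s : ℕ → ℝ := fun k => 1 - 1 / ((k : ℝ) + 1) with hs
  have hs0 : ∀ k, 0 ≤ s k := fun k => by
    rw [hs, sub_nonneg, div_le_one (by positivity)]
    linarith [Nat.cast_nonneg (α := ℝ) k]
  have hs1 : ∀ k, s k < 1 := fun k => sub_lt_self _ (by positivity)
  have hlim : Filter.Tendsto s Filter.atTop (nhds 1) := by
    simpa [hs] using (tendsto_const_nhds (x := (1 : ℝ))).sub tendsto_one_div_add_atTop_nhds_zero_nat
  -- A factor `s k < 1` shortens the triple, so by minimality it is no longer blocked. Compactness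
  -- then allows `s k → 1`.
  have hex : ∀ k, ∃ t : Plane, ∀ i, s k • x i + t ∈ interior T := by
    intro k
    by_contra! hc
    have := hx.le (s k • x) hc
    rw [perimeter_smul (hs0 k)] at this
    nlinarith [hs1 k]
  choose t ht using hex
  obtain ⟨p, -, φ, hφ, hp⟩ := hT.isCompact.tendsto_subseq
    (x := fun k => s k • x 0 + t k) fun k => interior_subset (ht k 0)
  have hsφ := hlim.comp hφ.tendsto_atTop
  refine ⟨p - x 0, fun i => ?_⟩
  have h1 : Filter.Tendsto (fun k => s (φ k) • (x i - x 0) + (s (φ k) • x 0 + t (φ k)))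
      Filter.atTop (nhds ((1 : ℝ) • (x i - x 0) + p)) := (hsφ.smul_const _).add hp
  rw [one_smul, show x i - x 0 + p = x i + (p - x 0) by abel] at h1
  refine hT.isCompact.isClosed.mem_of_tendsto h1 (Filter.Eventually.of_forall fun k => ?_)
  have h2 := interior_subset (ht (φ k) i)
  rwa [show s (φ k) • (x i - x 0) + (s (φ k) • x 0 + t (φ k)) = s (φ k) • x i + t (φ k) by
    rw [smul_sub]; abel]

theorem IsMinimalBlocked.certificate {T : Set Plane} (hT : IsTable T) {x : ZMod 3 → Plane}
    (hx : IsMinimalBlocked T x) (hnd : Nondegenerate x) : Certificate T x (triangleNormal x) := by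
  obtain ⟨n, hn⟩ := hx.blocked.exists_certificate hT
  obtain ⟨κ, hκ, h⟩ := hx.exists_triangleNormal_eq hT hnd hn
  exact h ▸ hn.smul hκ

theorem IsOutwardSupportVector.mem_frontier {T : Set Plane} {q ν : Plane} (hq : q ∈ T)
    (hν : ν ≠ 0) (h : IsOutwardSupportVector T q ν) : q ∈ frontier T := by
  refine ⟨subset_closure hq, fun hint => ?_⟩
  have hc : Continuous fun ε : ℝ => q + ε • ν := by fun_prop
  have h0 : (fun ε : ℝ => q + ε • ν) ⁻¹' interior T ∈ nhds (0 : ℝ) :=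
    (isOpen_interior.preimage hc).mem_nhds (by simpa using hint)
  obtain ⟨ε, hε, hball⟩ := Metric.mem_nhds_iff.1 h0
  have hm := hball (show ε / 2 ∈ Metric.ball (0 : ℝ) ε by
    rw [Metric.mem_ball, Real.dist_eq, sub_zero, abs_of_pos (by positivity)]; linarith)
  have := h _ (interior_subset hm)
  rw [add_sub_cancel_left, inner_smul_left, RCLike.conj_to_real, real_inner_self_eq_norm_sq] at this
  have h2 := norm_pos_iff.2 hν
  have : 0 < ε / 2 * ‖ν‖ ^ 2 := by positivity
  linarith

/-- Only the zero vector is a support vector in two opposite directions. -/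
theorem IsOutwardSupportVector.eq_zero_of_neg {T : Set Plane} (hT : (interior T).Nonempty)
    {q ν : Plane} (h : IsOutwardSupportVector T q ν) (h' : IsOutwardSupportVector T q (-ν)) :
    ν = 0 := by
  by_contra hν
  obtain ⟨p, hp⟩ := hT
  have hzero : ∀ y ∈ T, inner ℝ (y - q) ν = 0 := fun y hy => by
    have h1 := h y hy
    have h2 := h' y hy
    rw [inner_neg_right] at h2
    linarith
  have hsup : IsOutwardSupportVector T p ν := fun y hy => by
    have h1 := hzero y hy
    have h2 := hzero p (interior_subset hp)
    rw [← sub_sub_sub_cancel_right y p q, inner_sub_left]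
    linarith
  exact (hsup.mem_frontier (interior_subset hp) hν).2 hp

theorem IsOutwardSupportVector.smul {T : Set Plane} {q ν : Plane} {c : ℝ} (hc : 0 ≤ c)
    (h : IsOutwardSupportVector T q ν) : IsOutwardSupportVector T q (c • ν) := fun y hy => by
  rw [inner_smul_right]
  exact mul_nonpos_of_nonneg_of_nonpos hc (h y hy)

theorem IsOutwardSupportVector.add {T : Set Plane} {q ν μ : Plane}
    (h : IsOutwardSupportVector T q ν) (h' : IsOutwardSupportVector T q μ) :
    IsOutwardSupportVector T q (ν + μ) := fun y hy => by
  rw [inner_add_right]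
  exact add_nonpos (h y hy) (h' y hy)

/-- The support vectors at a vertex of a shortest blocked triple form a single ray. -/
theorem IsMinimalBlocked.exists_eq_smul {T : Set Plane} (hT : IsTable T) {x : ZMod 3 → Plane}
    (hx : IsMinimalBlocked T x) (hnd : Nondegenerate x) (hmem : ∀ i, x i ∈ T) (i : ZMod 3)
    {m : Plane} (hm : IsOutwardSupportVector T (x i) m) :
    ∃ c : ℝ, 0 ≤ c ∧ m = c • triangleNormal x i := by
  have hcert := hx.certificate hT hnd
  have hsup := hcert.isOutwardSupportVector hmem
  obtain ⟨β, γ, hβγ⟩ := hnd.exists_eq_smul_add_smul i m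
  have hsum := sum_triangleNormal x
  rw [sum_zmod_three _ i] at hsum
  set ν := triangleNormal x
  obtain ⟨K, hKβ, hKγ⟩ : ∃ K : ℝ, |β| < K ∧ |γ| < K :=
    ⟨|β| + |γ| + 1, by linarith [abs_nonneg γ], by linarith [abs_nonneg β]⟩
  have hK : 0 < K := (abs_nonneg β).trans_lt hKβ
  have hKβ' := (le_abs_self β).trans_lt hKβ
  have hKγ' := (le_abs_self γ).trans_lt hKγ
  -- Adding `m` at vertex `i` and compensating at the other two gives another certificate: the sum
  -- is `K` times the zero sum of the normals, and large `K` keeps the coefficients positive.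
  -- Uniqueness then makes `m` a multiple of `ν i`.
  set n : ZMod 3 → Plane := fun j => if j = i then K • ν i + m else
    if j = i + 1 then (K - β) • ν (i + 1) else (K - γ) • ν (i + 2) with hn
  have n0 : n i = K • ν i + m := if_pos rfl
  have n1 : n (i + 1) = (K - β) • ν (i + 1) := by
    simp [hn, zmod_three_add_one_ne i]
  have n2 : n (i + 2) = (K - γ) • ν (i + 2) := by
    rw [hn]
    simp only [if_neg (zmod_three_add_two_ne i), if_neg (zmod_three_add_two_ne_add_one i)]
  have hn_ne : n ≠ 0 := fun h => by
    have := congrFun h (i + 1)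
    rw [n1] at this
    exact (smul_ne_zero (by linarith) (hnd.triangleNormal_ne_zero (i + 1))) this
  have hn_sum : ∑ j, n j = 0 := by
    rw [sum_zmod_three _ i, n0, n1, n2, hβγ]
    have : ν i = -(ν (i + 1) + ν (i + 2)) := by
      rw [add_assoc] at hsum
      exact eq_neg_of_add_eq_zero_left hsum
    rw [this]
    module
  have hn_sup : ∀ j, IsOutwardSupportVector T (x j) (n j) := fun j => by
    rcases zmod_three_eq_or i j with rfl | rfl | rfl
    · rw [n0]
      exact ((hsup _).smul hK.le).add hm
    · rw [n1]
      exact (hsup _).smul (by linarith)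
    · rw [n2]
      exact (hsup _).smul (by linarith)
  obtain ⟨κ, hκ, h⟩ := hx.exists_triangleNormal_eq hT hnd
    (certificate_of_isOutwardSupportVector hn_ne hn_sum hn_sup)
  have e1 : κ * (K - β) = 1 := by
    have := congrFun h (i + 1)
    rw [Pi.smul_apply, n1, smul_smul] at this
    exact (smul_left_injective ℝ (hnd.triangleNormal_ne_zero (i + 1))
      (by simpa using this)).symm
  have e0 : m = (κ⁻¹ - K) • ν i := by
    have := congrFun h i
    rw [Pi.smul_apply, n0, ← inv_smul_eq_iff₀ hκ.ne'] at this
    rw [sub_smul]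
    exact eq_sub_of_add_eq' this.symm
  rcases le_or_gt 0 (κ⁻¹ - K) with hc | hc
  · exact ⟨_, hc, e0⟩
  -- A negative multiple would make both `ν i` and `-ν i` support vectors.
  · have hneg : IsOutwardSupportVector T (x i) (-ν i) := by
      have := hm.smul (c := (K - κ⁻¹)⁻¹) (inv_nonneg.2 (by linarith))
      rw [e0, smul_smul] at this
      rwa [← neg_one_smul ℝ, show (-1 : ℝ) = (K - κ⁻¹)⁻¹ * (κ⁻¹ - K) by
        rw [← neg_sub K, mul_neg, inv_mul_cancel₀ (by linarith)]]
    exact absurd ((hsup i).eq_zero_of_neg hT.nonempty_interior hneg)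
      (hnd.triangleNormal_ne_zero i)

theorem IsMinimalBlocked.isSmoothPoint {T : Set Plane} (hT : IsTable T) {x : ZMod 3 → Plane}
    (hx : IsMinimalBlocked T x) (hnd : Nondegenerate x) (hmem : ∀ i, x i ∈ T) (i : ZMod 3) :
    IsSmoothPoint T (x i) := by
  have hne := hnd.triangleNormal_ne_zero i
  have hsup := (hx.certificate hT hnd).isOutwardSupportVector hmem i
  have hpos := norm_pos_iff.2 hne
  refine ⟨hsup.mem_frontier (hmem i) hne, ‖triangleNormal x i‖⁻¹ • triangleNormal x i,
    ⟨?_, hsup.smul (by positivity)⟩, ?_⟩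
  · rw [norm_smul, norm_inv, norm_norm, inv_mul_cancel₀ hpos.ne']
  · rintro m ⟨hm1, hm⟩
    obtain ⟨c, hc, rfl⟩ := hx.exists_eq_smul hT hnd hmem i hm
    rw [norm_smul, Real.norm_of_nonneg hc] at hm1
    rw [eq_inv_of_mul_eq_one_left hm1]

/-! ### Triangles as periodic orbits. -/

/-- The 3-periodic sequence running through three points. -/
def cyclicSequence (x : ZMod 3 → Plane) : ℤ → Plane := fun i => x i

theorem bounceVector_cyclicSequence (x : ZMod 3 → Plane) (i : ℤ) :
    bounceVector (cyclicSequence x) i = triangleNormal x i := by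
  simp [bounceVector, cyclicSequence, triangleNormal]

theorem period_cyclicSequence {x : ZMod 3 → Plane} (hne : ∀ i, x (i + 1) ≠ x i) :
    3 ∈ periods (cyclicSequence x) ∧ period (cyclicSequence x) = 3 := by
  have h3 : 3 ∈ periods (cyclicSequence x) := by
    refine ⟨by norm_num, fun i => ?_⟩
    have : (3 : ZMod 3) = 0 := by decide
    simp [cyclicSequence, this]
  refine ⟨h3, le_antisymm (Nat.sInf_le h3) ?_⟩
  have hmem : period (cyclicSequence x) ∈ periods (cyclicSequence x) := Nat.sInf_mem ⟨3, h3⟩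
  by_contra! hlt
  have h2 : period (cyclicSequence x) = 2 := le_antisymm (by omega) hmem.1
  rw [h2] at hmem
  have := hmem.2 1
  have e : (((1 : ℤ) + (2 : ℕ) : ℤ) : ZMod 3) = 0 := by decide
  rw [cyclicSequence, cyclicSequence, e] at this
  exact hne 0 (by simpa using this.symm)

theorem cyclicSequence_mem_bounceOrbits {T : Set Plane} {x : ZMod 3 → Plane}
    (hfr : ∀ i, x i ∈ frontier T) (hne : ∀ i, x (i + 1) ≠ x i)
    (hsup : ∀ i, IsOutwardSupportVector T (x i) (triangleNormal x i)) :
    cyclicSequence x ∈ bounceOrbits 3 T := by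
  refine ⟨⟨⟨fun i => hfr i, fun i => ?_, fun i => ?_⟩, 3, (period_cyclicSequence hne).1⟩,
    (period_cyclicSequence hne).2⟩
  · simpa [cyclicSequence] using hne i
  · rw [bounceVector_cyclicSequence]
    exact hsup i

theorem length_cyclicSequence {x : ZMod 3 → Plane} (hne : ∀ i, x (i + 1) ≠ x i) :
    length (cyclicSequence x) = perimeter x := by
  rw [length, (period_cyclicSequence hne).2, perimeter, sum_zmod_three _ 0]
  simp [cyclicSequence, Finset.sum_range_succ]

/-- A shortest blocked triple is, up to translation, a 3-bounce orbit. -/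
theorem IsMinimalBlocked.exists_mem_closedOrbits {T : Set Plane} (hT : IsTable T)
    {x : ZMod 3 → Plane} (hx : IsMinimalBlocked T x) (hnd : Nondegenerate x) :
    ∃ q ∈ closedOrbits T, length q = perimeter x := by
  have hpos : 0 < perimeter x := by
    have h1 := norm_sub_le_perimeter x (0 + 1) 0
    have h2 := norm_pos_iff.2 (sub_ne_zero.2 (hnd.ne_succ 0))
    linarith
  obtain ⟨t, ht⟩ := hx.exists_translate hT hpos
  have hν : triangleNormal (fun i => x i + t) = triangleNormal x := by
    ext1 i
    simp [triangleNormal]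
  have hcert : Certificate T (fun i => x i + t) (triangleNormal x) :=
    (hx.certificate hT hnd).of_sum_eq ((hx.certificate hT hnd).sum_inner_add x t).ge
  have hsup := hcert.isOutwardSupportVector ht
  have hne : ∀ i, x (i + 1) + t ≠ x i + t := fun i => by simpa using hnd.ne_succ i
  refine ⟨cyclicSequence fun i => x i + t, (cyclicSequence_mem_bounceOrbits
    (fun i => (hsup i).mem_frontier (ht i) (hnd.triangleNormal_ne_zero i)) hne ?_).1, ?_⟩
  · rwa [hν]
  · rw [length_cyclicSequence hne, perimeter_add_const]

/-! ### Width and blocking under scaled inclusions. -/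

theorem IsTable.exists_band {T : Set Plane} (hT : IsTable T) : {d : ℝ | ∃ u : Plane, ‖u‖ = 1 ∧
    ∃ a : ℝ, ∀ x ∈ T, a ≤ inner ℝ u x ∧ inner ℝ u x ≤ a + d}.Nonempty := by
  obtain ⟨R, hR⟩ := hT.isCompact.isBounded.exists_norm_le
  obtain ⟨u, hu⟩ := exists_norm_eq Plane zero_le_one
  refine ⟨2 * R, u, hu, -R, fun x hx => ?_⟩
  have h1 := abs_le.1 ((abs_real_inner_le_norm u x).trans (by simpa [hu] using hR x hx : _ ≤ R))
  exact ⟨h1.1, by linarith [h1.2]⟩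

theorem mul_width_le {T T' : Set Plane} (hT : T.Nonempty) (hT' : IsTable T') {r : ℝ} (hr : 0 < r)
    (hsub : r • T ⊆ T') : r * width T ≤ width T' := by
  refine le_csInf hT'.exists_band ?_
  rintro d ⟨u, hu, a, h⟩
  rw [mul_comm, ← le_div_iff₀ hr]
  refine csInf_le (bddBelow_bands T hT) ⟨u, hu, a / r, fun x hx => ?_⟩
  obtain ⟨h1, h2⟩ := h _ (hsub (Set.smul_mem_smul_set hx))
  rw [inner_smul_right] at h1 h2
  rw [← add_div, div_le_iff₀ hr, le_div_iff₀ hr, mul_comm]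
  exact ⟨h1, h2⟩

theorem Blocked.smul {ι : Type*} {T T' : Set Plane} {x : ι → Plane} (hx : Blocked T x) {r : ℝ}
    (hr : 0 < r) (hsub : T' ⊆ r • T) : Blocked T' (r • x) := by
  intro t
  obtain ⟨i, hi⟩ := hx (r⁻¹ • t)
  refine ⟨i, fun hc => hi ?_⟩
  have h1 := interior_mono hsub hc
  rw [interior_smul₀ hr.ne', Set.mem_smul_set_iff_inv_smul_mem₀ hr.ne', smul_add, Pi.smul_apply,
    inv_smul_smul₀ hr.ne'] at h1
  exact h1

/-! ### Closed orbits are blocked, and Helly's theorem. -/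

section ClosedOrbit

variable {T : Set Plane} {q : ℤ → Plane}

theorem period_mem (h : (periods q).Nonempty) : period q ∈ periods q := Nat.sInf_mem h

theorem sum_range_shift {M : Type*} [AddCommGroup M] {f : ℤ → M} {n : ℕ}
    (hf : ∀ i : ℤ, f (i + n) = f i) :
    ∑ i ∈ Finset.range n, f ((i : ℤ) + 1) = ∑ i ∈ Finset.range n, f i := by
  rw [← sub_eq_zero, ← Finset.sum_sub_distrib]
  have := Finset.sum_range_sub (fun i : ℕ => f i) n
  push_cast at this
  rw [this, sub_eq_zero]
  simpa using hf 0

/-- A closed orbit cannot be translated into the interior of the table. -/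
theorem exists_add_notMem_interior (hq : q ∈ closedOrbits T) (t : Plane) :
    ∃ i ∈ Finset.range (period q), q i + t ∉ interior T := by
  have hper := period_mem hq.2
  set n := period q
  have hn : 0 < n := lt_of_lt_of_le two_pos hper.1
  set u : ℤ → Plane := fun i => (‖q (i + 1) - q i‖⁻¹) • (q (i + 1) - q i) with hu
  have hbounce : ∀ i, bounceVector q i = u (i - 1) - u i := fun i => by
    simp only [bounceVector, hu, sub_add_cancel]
    rw [← neg_sub (q (i + 1)) (q i), smul_neg, norm_neg, ← sub_eq_add_neg]
  have hu_per : ∀ i : ℤ, u (i + n) = u i := fun i => by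
    simp only [hu]
    rw [hper.2, add_right_comm, hper.2]
  have hsum : ∑ i ∈ Finset.range n, bounceVector q i = 0 := by
    simp only [hbounce, Finset.sum_sub_distrib]
    rw [sub_eq_zero, ← sum_range_shift (f := fun i => u (i - 1))]
    · simp
    · intro i
      rw [add_sub_right_comm]
      exact hu_per _
  -- Summation by parts: the bounce vectors are differences of unit edge directions, so pairing them
  -- with the points recovers the length. Being positive, it shows that not all bounce vectors
  -- vanish.
  have hinner : ∑ i ∈ Finset.range n, inner ℝ (bounceVector q i) (q i) =
      ∑ i ∈ Finset.range n, ‖q ((i : ℤ) + 1) - q i‖ := by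
    simp only [hbounce, inner_sub_left, Finset.sum_sub_distrib]
    rw [← sum_range_shift (f := fun i => inner ℝ (u (i - 1)) (q i)), ← Finset.sum_sub_distrib]
    · refine Finset.sum_congr rfl fun i _ => ?_
      rw [add_sub_cancel_right, ← inner_sub_right]
      exact inner_inv_norm_smul_self _
    · intro i
      rw [add_sub_right_comm, hu_per, hper.2]
  have hpos : 0 < ∑ i ∈ Finset.range n, ‖q ((i : ℤ) + 1) - q i‖ :=
    Finset.sum_pos (fun i _ => norm_pos_iff.2 (sub_ne_zero.2 (hq.1.ne_succ i)))
      (Finset.nonempty_range_iff.2 hn.ne')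
  have hcert : Certificate T (fun i : Fin n => q i) fun i : Fin n => bounceVector q i := by
    refine certificate_of_isOutwardSupportVector (fun h0 => hpos.ne' ?_) ?_
      fun i => hq.1.support i
    · rw [← hinner]
      refine Finset.sum_eq_zero fun i hi => ?_
      have : bounceVector q i = 0 := congrFun h0 ⟨i, Finset.mem_range.1 hi⟩
      rw [this, inner_zero_left]
    · rw [← hsum, Finset.sum_range]
  obtain ⟨i, hi⟩ := hcert.blocked t
  exact ⟨i, Finset.mem_range.2 i.2, hi⟩

/-- Ordered indices are needed so that the chords can be compared with consecutive arcs of the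
orbit; repetitions pad smaller sets. -/
theorem exists_le_le_of_card_le_three {n : ℕ} (hn : 0 < n) {I : Finset ℕ} (hI : I ⊆ Finset.range n)
    (hcard : I.card ≤ 3) : ∃ i j k : ℕ, i ≤ j ∧ j ≤ k ∧ k < n ∧ I ⊆ {i, j, k} := by
  rcases I.eq_empty_or_nonempty with rfl | hne
  · exact ⟨0, 0, 0, le_rfl, le_rfl, hn, by simp⟩
  · set i := I.min' hne
    set k := I.max' hne
    have hik : i ≤ k := I.min'_le_max' hne
    have hk : k < n := Finset.mem_range.1 (hI (I.max'_mem hne))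
    have hcard' : ((I.erase i).erase k).card ≤ 1 ∨ I ⊆ {i} := by
      rcases eq_or_ne k i with h | h
      · right
        intro m hm
        have h1 := I.min'_le m hm
        have h2 := I.le_max' m hm
        rw [Finset.mem_singleton]
        omega
      · left
        rw [Finset.card_erase_of_mem (Finset.mem_erase.2 ⟨h, I.max'_mem hne⟩),
          Finset.card_erase_of_mem (I.min'_mem hne)]
        omega
    rcases hcard' with h | h
    · rcases ((I.erase i).erase k).eq_empty_or_nonempty with he | ⟨j, hj⟩
      · refine ⟨i, i, k, le_rfl, hik, hk, fun m hm => ?_⟩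
        by_contra hc
        have : m ∈ (I.erase i).erase k := by
          simp at hc
          simp [hc, hm]
        rw [he] at this
        exact absurd this (Finset.notMem_empty m)
      · have hjI : j ∈ I := Finset.mem_of_mem_erase (Finset.mem_of_mem_erase hj)
        refine ⟨i, j, k, I.min'_le j hjI, I.le_max' j hjI, hk, fun m hm => ?_⟩
        by_contra hc
        simp only [Finset.mem_insert, Finset.mem_singleton, not_or] at hc
        have : m ∈ (I.erase i).erase k := by simp [hc, hm]
        exact hc.2.1 (Finset.card_le_one.1 h m this j hj)
    · exact ⟨i, i, k, le_rfl, hik, hk, h.trans (by simp)⟩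

/-- The triple of points of a sequence with given indices. -/
def subtriple (q : ℤ → Plane) (i j k : ℤ) : ZMod 3 → Plane := ![q i, q j, q k]

theorem perimeter_subtriple (q : ℤ → Plane) (i j k : ℤ) :
    perimeter (subtriple q i j k) = ‖q j - q i‖ + ‖q k - q j‖ + ‖q i - q k‖ :=
  perimeter_eq _ 0

/-- By Helly's theorem, three bounce points of a closed orbit are blocked. -/
theorem exists_blocked_subtriple (hT : IsTable T) (hq : q ∈ closedOrbits T) :
    ∃ i j k : ℕ, i ≤ j ∧ j ≤ k ∧ k < period q ∧ Blocked T (subtriple q i j k) := by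
  have hn : 0 < period q := lt_of_lt_of_le two_pos (period_mem hq.2).1
  by_contra! hc
  -- Each bounce point defines the convex set of translations carrying it into the interior. In
  -- dimension two, a common point for every three of them gives one for all.
  have hhelly := Convex.helly_theorem' (𝕜 := ℝ) (s := Finset.range (period q))
    (F := fun i : ℕ => (fun s => q i + s) ⁻¹' interior T)
    (fun i _ => hT.convex.interior.translate_preimage_right _) fun I hI hcard => ?_
  · obtain ⟨t, ht⟩ := hhelly
    obtain ⟨i, hi, hit⟩ := exists_add_notMem_interior hq t
    exact hit (Set.mem_iInter₂.1 ht i hi)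
  · rw [finrank_euclideanSpace_fin] at hcard
    obtain ⟨i, j, k, hij, hjk, hk, hsub⟩ := exists_le_le_of_card_le_three hn hI hcard
    have hnb := hc i j k hij hjk hk
    unfold Blocked at hnb
    push Not at hnb
    obtain ⟨t, ht⟩ := hnb
    refine ⟨t, Set.mem_iInter₂.2 fun m hm => ?_⟩
    have h3 := hsub hm
    simp only [Finset.mem_insert, Finset.mem_singleton] at h3
    rcases h3 with rfl | rfl | rfl
    · exact ht 0
    · exact ht 1
    · exact ht 2

theorem sum_Ico_eq_length (h : (periods q).Nonempty) (i : ℕ) :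
    ∑ m ∈ Finset.Ico i (i + period q), ‖q ((m : ℤ) + 1) - q m‖ = length q := by
  induction i with
  | zero => rw [zero_add, ← Finset.range_eq_Ico]; rfl
  | succ i ih =>
    have hn : 0 < period q := lt_of_lt_of_le two_pos (period_mem h).1
    rw [← ih, add_right_comm, Finset.sum_Ico_succ_top (by omega),
      Finset.sum_eq_sum_Ico_succ_bot (show i < i + period q by omega), add_comm]
    push_cast
    rw [add_right_comm, (period_mem h).2, (period_mem h).2]

theorem norm_sub_le_sum_Ico (q : ℤ → Plane) {i j : ℕ} (hij : i ≤ j) :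
    ‖q j - q i‖ ≤ ∑ m ∈ Finset.Ico i j, ‖q ((m : ℤ) + 1) - q m‖ := by
  have := dist_le_Ico_sum_dist (fun m : ℕ => q m) hij
  simpa only [dist_eq_norm, norm_sub_rev (q _) (q (_ + 1)), norm_sub_rev (q (i : ℤ)), Nat.cast_add,
    Nat.cast_one] using this

theorem length_eq_add_add (h : (periods q).Nonempty) {i j k : ℕ} (hij : i ≤ j) (hjk : j ≤ k)
    (hk : k ≤ i + period q) :
    length q = ∑ m ∈ Finset.Ico i j, ‖q ((m : ℤ) + 1) - q m‖ +
      ∑ m ∈ Finset.Ico j k, ‖q ((m : ℤ) + 1) - q m‖ +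
      ∑ m ∈ Finset.Ico k (i + period q), ‖q ((m : ℤ) + 1) - q m‖ := by
  rw [Finset.sum_Ico_consecutive _ hij hjk, Finset.sum_Ico_consecutive _ (hij.trans hjk) hk,
    sum_Ico_eq_length h]

theorem perimeter_subtriple_le (h : (periods q).Nonempty) {i j k : ℕ} (hij : i ≤ j) (hjk : j ≤ k)
    (hk : k ≤ i + period q) : perimeter (subtriple q i j k) ≤ length q := by
  rw [perimeter_subtriple, length_eq_add_add h hij hjk hk]
  have h3 := norm_sub_le_sum_Ico q hk
  rw [Nat.cast_add, (period_mem h).2] at h3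
  exact add_le_add (add_le_add (norm_sub_le_sum_Ico q hij) (norm_sub_le_sum_Ico q hjk)) h3

end ClosedOrbit

/-! ### Exclusion of further bounce points. -/

theorem IsTable.exists_isOutwardSupportVector {T : Set Plane} (hT : IsTable T) {q : Plane}
    (hq : q ∈ frontier T) : ∃ u : Plane, u ≠ 0 ∧ IsOutwardSupportVector T q u := by
  obtain ⟨f, hf⟩ := geometric_hahn_banach_open_point hT.convex.interior isOpen_interior hq.2
  have hinner : ∀ y, inner ℝ ((InnerProductSpace.toDual ℝ Plane).symm f) y = f y := fun y =>
    InnerProductSpace.toDual_symm_apply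
  refine ⟨(InnerProductSpace.toDual ℝ Plane).symm f, fun h0 => ?_, fun y hy => ?_⟩
  · obtain ⟨p, hp⟩ := hT.nonempty_interior
    have := hf p hp
    rw [← hinner, ← hinner, h0, inner_zero_left, inner_zero_left] at this
    exact lt_irrefl _ this
  · rw [real_inner_comm, hinner, map_sub, sub_nonpos]
    have hcl : y ∈ closure (interior T) := by
      rw [hT.convex.closure_interior_eq_closure_of_nonempty_interior hT.nonempty_interior]
      exact subset_closure hy
    exact closure_minimal (fun z hz => (hf z hz).le) (isClosed_le f.continuous continuous_const) hcl

/-- The normal is a difference of unit vectors; if orthogonal to one of them, it forces them to be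
equal and so vanishes. -/
theorem Nondegenerate.inner_triangleNormal_ne_zero {x : ZMod 3 → Plane} (hx : Nondegenerate x)
    (i : ZMod 3) : inner ℝ (triangleNormal x i) (x (i + 1) - x i) ≠ 0 := by
  intro h
  have h1 : inner ℝ (triangleNormal x i) (edgeDirection x i) = 0 := by
    rw [edgeDirection, inner_smul_right, h, mul_zero]
  have hne := hx.triangleNormal_ne_zero i
  rw [triangleNormal_eq] at h1 hne
  rw [inner_sub_left, real_inner_self_eq_norm_sq, hx.norm_edgeDirection, one_pow, sub_eq_zero,
    inner_eq_one_iff_of_norm_eq_one (hx.norm_edgeDirection _) (hx.norm_edgeDirection _)] at h1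
  exact hne (sub_eq_zero.2 h1)

/-- The open edges of a shortest blocked triple in `T` do not meet the frontier of `T`. -/
theorem IsMinimalBlocked.notMem_frontier {T : Set Plane} (hT : IsTable T) {x : ZMod 3 → Plane}
    (hx : IsMinimalBlocked T x) (hnd : Nondegenerate x) (hmem : ∀ i, x i ∈ T) (i : ZMod 3)
    {m : Plane} (hm : m ∈ openSegment ℝ (x i) (x (i + 1))) : m ∉ frontier T := by
  intro hfr
  obtain ⟨u, hu, hsup⟩ := hT.exists_isOutwardSupportVector hfr
  rw [openSegment_eq_image'] at hm
  obtain ⟨s, ⟨hs0, hs1⟩, rfl⟩ := hm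
  have h1 := hsup _ (hmem i)
  have h2 := hsup _ (hmem (i + 1))
  set d := x (i + 1) - x i with hd
  rw [show x i - (x i + s • d) = (-s) • d by rw [neg_smul]; abel, inner_smul_left,
    RCLike.conj_to_real] at h1
  rw [show x (i + 1) - (x i + s • d) = (1 - s) • d by rw [sub_smul, one_smul, hd]; abel,
    inner_smul_left, RCLike.conj_to_real] at h2
  -- The support inequality at the two ends of the edge has opposite signs, so `u` is orthogonal to
  -- the edge and also supports `T` at `x i`. There, however, only multiples of the billiard normal
  -- are available.
  have hdu : inner ℝ d u = 0 := by
    refine le_antisymm ?_ ?_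
    · exact nonpos_of_mul_nonpos_right h2 (by linarith)
    · by_contra! hneg
      nlinarith
  have hsup' : IsOutwardSupportVector T (x i) u := fun y hy => by
    have := hsup y hy
    rwa [← sub_sub, inner_sub_left, inner_smul_left, hdu, mul_zero, sub_zero] at this
  obtain ⟨c, hc, rfl⟩ := hx.exists_eq_smul hT hnd hmem i hsup'
  rw [inner_smul_right, real_inner_comm] at hdu
  rcases mul_eq_zero.1 hdu with h | h
  · exact hu (by rw [h, zero_smul])
  · exact hnd.inner_triangleNormal_ne_zero i h

/-- Rotation carries the statement about the gap between the first two indices to all three gaps,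
the last one wrapping around the period. -/
theorem Blocked.subtriple_rotate {T : Set Plane} {q : ℤ → Plane} (h : (periods q).Nonempty)
    {i j k : ℕ} (hb : Blocked T (subtriple q i j k)) :
    Blocked T (subtriple q j k (i + period q : ℕ)) := by
  intro t
  obtain ⟨l, hl⟩ := hb t
  have hper : q (i + period q : ℕ) = q i := by
    rw [Nat.cast_add, (period_mem h).2]
  rcases zmod_three_eq_or 0 l with rfl | rfl | rfl
  · exact ⟨2, by rwa [← show q (i + period q : ℕ) = subtriple q i j k 0 from hper] at hl⟩
  · exact ⟨0, hl⟩
  · exact ⟨1, hl⟩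

theorem perimeter_subtriple_rotate {q : ℤ → Plane} (h : (periods q).Nonempty) (i j k : ℕ) :
    perimeter (subtriple q j k (i + period q : ℕ)) = perimeter (subtriple q i j k) := by
  rw [perimeter_subtriple, perimeter_subtriple, Nat.cast_add, (period_mem h).2]
  ring

/-- If a shortest blocked triple of bounce points is as long as the whole orbit, then there are no
further bounce points between its first two points. -/
theorem IsMinimalBlocked.eq_succ {T : Set Plane} (hT : IsTable T) {q : ℤ → Plane}
    (hq : q ∈ closedOrbits T) {i j k : ℕ} (hij : i ≤ j) (hjk : j ≤ k) (hk : k ≤ i + period q)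
    (hx : IsMinimalBlocked T (subtriple q i j k)) (hnd : Nondegenerate (subtriple q i j k))
    (hlen : perimeter (subtriple q i j k) = length q) : j = i + 1 := by
  have hmem : ∀ l, q l ∈ T := fun l => hT.isCompact.isClosed.frontier_subset (hq.1.mem_frontier l)
  have hne : q j ≠ q i := hnd.ne_succ 0
  have hji : i ≠ j := by
    rintro rfl
    exact hne rfl
  by_contra hgap
  have hle : i + 2 ≤ j := by omega
  have h1 := length_eq_add_add hq.2 hij hjk hk
  rw [← hlen, perimeter_subtriple] at h1
  have h2 := norm_sub_le_sum_Ico q hjk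
  have h3 := norm_sub_le_sum_Ico q hk
  rw [Nat.cast_add, (period_mem hq.2).2] at h3
  -- The other two arcs are at least as long as their chords, so this arc cannot exceed its chord.
  -- Equality in the triangle inequality then puts the extra bounce point on the open edge.
  have h4 : ∑ m ∈ Finset.Ico i j, ‖q ((m : ℤ) + 1) - q m‖ ≤ ‖q j - q i‖ := by linarith
  rw [← Finset.sum_Ico_consecutive _ (show i ≤ i + 2 by omega) hle,
    Finset.sum_Ico_succ_top (by omega), Finset.sum_Ico_succ_top (by omega), Finset.Ico_self,
    Finset.sum_empty, zero_add] at h4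
  have h5 := norm_sub_le_sum_Ico q hle
  push_cast at h4 h5
  rw [add_assoc (i : ℤ) 1 1, one_add_one_eq_two] at h4
  have hs1 : q ((i : ℤ) + 1) ≠ q i := hq.1.ne_succ i
  have hs2 : q ((i : ℤ) + 2) ≠ q ((i : ℤ) + 1) := by
    have := hq.1.ne_succ ((i : ℤ) + 1)
    rwa [add_assoc, one_add_one_eq_two] at this
  have hp2 := norm_pos_iff.2 (sub_ne_zero.2 hs2)
  have hnj : q ((i : ℤ) + 1) ≠ q j := fun h => by
    rw [h] at h4 hp2
    linarith [norm_nonneg (q j - q ((i : ℤ) + 2))]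
  have htri := norm_sub_le_norm_sub_add_norm_sub (q j) (q ((i : ℤ) + 2)) (q ((i : ℤ) + 1))
  have htri' := norm_sub_le_norm_sub_add_norm_sub (q j) (q ((i : ℤ) + 1)) (q i)
  have hw : Wbtw ℝ (q i) (q ((i : ℤ) + 1)) (q j) := by
    rw [← dist_add_dist_eq_iff, dist_eq_norm', dist_eq_norm', dist_eq_norm']
    linarith
  have hseg : q ((i : ℤ) + 1) ∈ openSegment ℝ (q i) (q j) :=
    mem_openSegment_of_ne_left_right hs1.symm hnj.symm (mem_segment_iff_wbtw.2 hw)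
  refine hx.notMem_frontier hT hnd (fun l => ?_) 0 hseg (hq.1.mem_frontier _)
  rcases zmod_three_eq_or 0 l with rfl | rfl | rfl
  exacts [hmem i, hmem j, hmem k]

theorem shortestOrbits_of_blocked {T : Set Plane} (hT : IsTable T) {y : ZMod 3 → Plane}
    (hy : Blocked T y) (hlt : perimeter y < 2 * width T) :
    (shortestOrbits T).Nonempty ∧ shortestOrbits T ⊆ regularBounceOrbits 3 T := by
  obtain ⟨x, hx⟩ := exists_isMinimalBlocked hy
  have hxlt : perimeter x < 2 * width T := (hx.le y hy).trans_lt hlt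
  obtain ⟨q₀, hq₀, hlen₀⟩ := hx.exists_mem_closedOrbits hT (hx.blocked.nondegenerate hT hxlt)
  have hlow : ∀ p ∈ closedOrbits T, perimeter x ≤ length p := by
    intro p hp
    obtain ⟨i, j, k, hij, hjk, hk, hb⟩ := exists_blocked_subtriple hT hp
    exact (hx.le _ hb).trans (perimeter_subtriple_le hp.2 hij hjk (by omega))
  refine ⟨⟨q₀, hq₀, fun p hp => hlen₀ ▸ hlow p hp⟩, fun q hq => ?_⟩
  have hqlen : length q = perimeter x := le_antisymm (hlen₀ ▸ hq.2 q₀ hq₀) (hlow q hq.1)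
  obtain ⟨i, j, k, hij, hjk, hk, hb⟩ := exists_blocked_subtriple hT hq.1
  have hper := hq.1.2
  have hle := perimeter_subtriple_le hper hij hjk (by omega)
  have hlen : perimeter (subtriple q i j k) = length q := le_antisymm hle (hqlen ▸ hx.le _ hb)
  have hmin : ∀ {z}, Blocked T z → perimeter z = length q →
      IsMinimalBlocked T z ∧ Nondegenerate z := fun hz he =>
    ⟨⟨hz, fun w hw => by rw [he, hqlen]; exact hx.le w hw⟩, hz.nondegenerate hT (by linarith)⟩
  have hb₂ := hb.subtriple_rotate hper
  have hlen₂ := (perimeter_subtriple_rotate hper i j k).trans hlen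
  have hb₃ := hb₂.subtriple_rotate hper
  have hlen₃ := (perimeter_subtriple_rotate hper j k (i + period q)).trans hlen₂
  obtain ⟨hm, hnd⟩ := hmin hb hlen
  have e1 : j = i + 1 := hm.eq_succ hT hq.1 hij hjk (by omega) hnd hlen
  have e2 : k = j + 1 := (hmin hb₂ hlen₂).1.eq_succ hT hq.1 hjk (by omega) (by omega)
    (hmin hb₂ hlen₂).2 hlen₂
  have e3 : i + period q = k + 1 := (hmin hb₃ hlen₃).1.eq_succ hT hq.1 (by omega) (by omega)
    (by omega) (hmin hb₃ hlen₃).2 hlen₃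
  have hp3 : period q = 3 := by omega
  refine ⟨⟨hq.1, hp3⟩, fun m => ?_⟩
  have hmem : ∀ l, q l ∈ T := fun l =>
    hT.isCompact.isClosed.frontier_subset (hq.1.1.mem_frontier l)
  have hsmooth := fun l => hm.isSmoothPoint hT hnd (fun l => by
    rcases zmod_three_eq_or 0 l with rfl | rfl | rfl
    exacts [hmem i, hmem j, hmem k]) l
  have hperiodic : Function.Periodic q (3 : ℤ) := fun l => by
    have := (period_mem hper).2 l
    rwa [hp3] at this
  have hmq : q m = q (i + (m - i) % 3) := by
    conv_lhs => rw [show m = i + (m - i) % 3 + (m - i) / 3 * 3 by omega]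
    exact hperiodic.int_mul _ _
  have hr : (m - i) % 3 = 0 ∨ (m - i) % 3 = 1 ∨ (m - i) % 3 = 2 := by omega
  rw [hmq]
  rcases hr with h | h | h <;> rw [h]
  · rw [add_zero]
    exact hsmooth 0
  · have := hsmooth 1
    rw [e1] at this
    exact_mod_cast this
  · have := hsmooth 2
    rw [e2, e1] at this
    exact_mod_cast this

theorem shortestOrbits_of_smul_subset {T T' : Set Plane} (hT : IsTable T) {c : ℤ → Plane}
    (hc : c ∈ bounceOrbits 3 T) (hT' : IsTable T') {r₁ r₂ : ℝ} (h₁ : 0 < r₁) (h₂ : 0 < r₂)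
    (hsub₁ : r₁ • T ⊆ T') (hsub₂ : T' ⊆ r₂ • T) (hr : r₂ / r₁ < 2 * width T / length c) :
    (shortestOrbits T').Nonempty ∧ shortestOrbits T' ⊆ regularBounceOrbits 3 T' := by
  obtain ⟨i, j, k, hij, hjk, hk, hb⟩ := exists_blocked_subtriple hT hc.1
  have hle := perimeter_subtriple_le hc.1.2 hij hjk (by omega)
  refine shortestOrbits_of_blocked hT' (hb.smul h₂ hsub₂) ?_
  rw [perimeter_smul h₂.le]
  have hw := mul_width_le hT.nonempty hT' h₁ hsub₁
  -- For zero length the quotient in `hr` is `0` by convention, contradicting the positivity of `r₂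
  -- / r₁`.
  rcases ((perimeter_nonneg _).trans hle).eq_or_lt with h0 | hpos
  · rw [← h0, div_zero] at hr
    exact absurd hr (not_lt.2 (by positivity))
  · rw [div_lt_div_iff₀ h₁ hpos] at hr
    calc r₂ * perimeter (subtriple c i j k) ≤ r₂ * length c := by gcongr
      _ < 2 * width T * r₁ := hr
      _ ≤ 2 * width T' := by linarith

/-! ### The equilateral triangle: Fagnano orbit and width. -/

theorem real_inner_plane (u v : Plane) : inner ℝ u v = u 0 * v 0 + u 1 * v 1 := by
  simp [PiLp.inner_apply, Fin.sum_univ_two, mul_comm]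

theorem gram_identity (a b u : Plane) :
    ‖b‖ ^ 2 * inner ℝ u a ^ 2 - 2 * inner ℝ a b * inner ℝ u a * inner ℝ u b +
      ‖a‖ ^ 2 * inner ℝ u b ^ 2 = (‖a‖ ^ 2 * ‖b‖ ^ 2 - inner ℝ a b ^ 2) * ‖u‖ ^ 2 := by
  simp only [← real_inner_self_eq_norm_sq, real_inner_plane]
  ring

/-- In the plane, two vectors orthogonal to a nonzero vector are parallel. -/
theorem norm_sq_smul_eq_of_inner_eq_zero {v w m : Plane} (hv : v ≠ 0) (hw : inner ℝ v w = 0)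
    (hm : inner ℝ v m = 0) : ‖w‖ ^ 2 • m = inner ℝ w m • w := by
  have hv' := norm_pos_iff.2 hv
  have hv2 : ‖v‖ ^ 2 * (m 0 * w 1 - m 1 * w 0) = 0 := by
    rw [real_inner_plane] at hw hm
    rw [← real_inner_self_eq_norm_sq, real_inner_plane]
    linear_combination (v 0 * w 1 - v 1 * w 0) * hm - (v 0 * m 1 - v 1 * m 0) * hw
  have h := (mul_eq_zero.1 hv2).resolve_left (by positivity)
  ext i
  simp only [PiLp.smul_apply, smul_eq_mul, ← real_inner_self_eq_norm_sq, real_inner_plane]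
  revert i
  rw [Fin.forall_fin_two]
  constructor
  · linear_combination w 1 * h
  · linear_combination -(w 0) * h

section Equilateral

variable {p : ZMod 3 → Plane}

theorem inner_eq_half (hp : ∀ i, ‖p (i + 1) - p i‖ = 1) (i : ZMod 3) :
    inner ℝ (p (i + 1) - p i) (p (i + 2) - p i) = 1 / 2 := by
  have h0 := hp i
  have h1 := hp (i + 1)
  have h2 := hp (i + 2)
  rw [zmod_three_add_one_add_one] at h1
  rw [zmod_three_add_two_add_one] at h2
  have h := norm_sub_sq_real (p (i + 2) - p i) (p (i + 1) - p i)
  rw [sub_sub_sub_cancel_right, h1, norm_sub_rev (p (i + 2)), h2, h0] at h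
  rw [real_inner_comm]
  linarith

/-- The midpoint of the edge opposite to a vertex. -/
noncomputable def oppositeMidpoint (p : ZMod 3 → Plane) (i : ZMod 3) : Plane :=
  midpoint ℝ (p (i + 1)) (p (i + 2))

theorem oppositeMidpoint_eq (p : ZMod 3 → Plane) (i : ZMod 3) :
    oppositeMidpoint p i = (1 / 2 : ℝ) • (p (i + 1) + p (i + 2)) := by
  rw [oppositeMidpoint, midpoint_eq_smul_add, invOf_eq_inv, one_div]

theorem oppositeMidpoint_sub (p : ZMod 3 → Plane) (i : ZMod 3) :
    oppositeMidpoint p (i + 1) - oppositeMidpoint p i = (-(1 / 2) : ℝ) • (p (i + 1) - p i) := by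
  rw [oppositeMidpoint_eq, oppositeMidpoint_eq, zmod_three_add_one_add_one,
    show i + 1 + 2 = i by revert i; decide]
  module

theorem norm_oppositeMidpoint_sub (hp : ∀ i, ‖p (i + 1) - p i‖ = 1) (i : ZMod 3) :
    ‖oppositeMidpoint p (i + 1) - oppositeMidpoint p i‖ = 1 / 2 := by
  rw [oppositeMidpoint_sub, norm_smul, hp]
  norm_num

theorem oppositeMidpoint_succ_ne (hp : ∀ i, ‖p (i + 1) - p i‖ = 1) (i : ZMod 3) :
    oppositeMidpoint p (i + 1) ≠ oppositeMidpoint p i := by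
  rw [← sub_ne_zero, ← norm_pos_iff, norm_oppositeMidpoint_sub hp]
  norm_num

theorem triangleNormal_oppositeMidpoint (hp : ∀ i, ‖p (i + 1) - p i‖ = 1) (i : ZMod 3) :
    triangleNormal (oppositeMidpoint p) i = (p (i + 1) - p i) + (p (i + 2) - p i) := by
  have h0 := norm_oppositeMidpoint_sub hp i
  have h1 := norm_oppositeMidpoint_sub hp (i - 1)
  rw [sub_add_cancel] at h1
  have h2 := oppositeMidpoint_sub p (i - 1)
  rw [sub_add_cancel] at h2
  rw [triangleNormal, h1, norm_sub_rev, h0, h2, ← neg_sub (oppositeMidpoint p (i + 1)),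
    oppositeMidpoint_sub, zmod_three_sub_one]
  module

theorem oppositeMidpoint_mem (p : ZMod 3 → Plane) (i : ZMod 3) :
    oppositeMidpoint p i ∈ convexHull ℝ (Set.range p) :=
  (convex_convexHull ℝ _).midpoint_mem (subset_convexHull ℝ _ ⟨_, rfl⟩)
    (subset_convexHull ℝ _ ⟨_, rfl⟩)

theorem convexHull_range_subset {s : Set Plane} (hs : Convex ℝ s) (i : ZMod 3) (h0 : p i ∈ s)
    (h1 : p (i + 1) ∈ s) (h2 : p (i + 2) ∈ s) : convexHull ℝ (Set.range p) ⊆ s := by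
  refine convexHull_min ?_ hs
  rintro _ ⟨j, rfl⟩
  rcases zmod_three_eq_or i j with rfl | rfl | rfl <;> assumption

theorem inner_edge_add (hp : ∀ i, ‖p (i + 1) - p i‖ = 1) (i : ZMod 3) :
    inner ℝ (p (i + 1) - p i) ((p (i + 1) - p i) + (p (i + 2) - p i)) = 3 / 2 ∧
      inner ℝ (p (i + 2) - p i) ((p (i + 1) - p i) + (p (i + 2) - p i)) = 3 / 2 := by
  have h2 := hp (i + 2)
  rw [zmod_three_add_two_add_one, norm_sub_rev] at h2
  rw [inner_add_right, inner_add_right, real_inner_self_eq_norm_sq, real_inner_self_eq_norm_sq,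
    hp, h2, real_inner_comm (p (i + 1) - p i) (p (i + 2) - p i), inner_eq_half hp]
  norm_num

theorem norm_edge_add_sq (hp : ∀ i, ‖p (i + 1) - p i‖ = 1) (i : ZMod 3) :
    ‖(p (i + 1) - p i) + (p (i + 2) - p i)‖ ^ 2 = 3 := by
  rw [← real_inner_self_eq_norm_sq, inner_add_left, (inner_edge_add hp i).1,
    (inner_edge_add hp i).2]
  norm_num

theorem edge_add_ne_zero (hp : ∀ i, ‖p (i + 1) - p i‖ = 1) (i : ZMod 3) :
    (p (i + 1) - p i) + (p (i + 2) - p i) ≠ 0 := fun h => by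
  have := norm_edge_add_sq hp i
  rw [h] at this
  norm_num at this

theorem isOutwardSupportVector_oppositeMidpoint (hp : ∀ i, ‖p (i + 1) - p i‖ = 1) (i : ZMod 3) :
    IsOutwardSupportVector (convexHull ℝ (Set.range p)) (oppositeMidpoint p i)
      ((p (i + 1) - p i) + (p (i + 2) - p i)) := by
  obtain ⟨h1, h2⟩ := inner_edge_add hp i
  set w := (p (i + 1) - p i) + (p (i + 2) - p i) with hw
  have hm : inner ℝ (oppositeMidpoint p i - p i) w = 3 / 2 := by
    rw [show oppositeMidpoint p i - p i =
        (1 / 2 : ℝ) • ((p (i + 1) - p i) + (p (i + 2) - p i)) by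
      rw [oppositeMidpoint_eq]; module, inner_smul_left, inner_add_left, h1, h2]
    norm_num
  have key : convexHull ℝ (Set.range p) ⊆ {y | inner ℝ w y ≤ inner ℝ w (oppositeMidpoint p i)} := by
    rw [inner_sub_left, real_inner_comm, real_inner_comm w (p i)] at h1 h2 hm
    refine convexHull_range_subset
      (convex_halfSpace_le (innerSL ℝ w).isBoundedLinearMap.toIsLinearMap _) i ?_ ?_ ?_ <;>
      simp only [Set.mem_ofPred_eq] <;> linarith
  intro y hy
  rw [real_inner_comm, inner_sub_right, sub_nonpos]
  exact key hy

theorem isSmoothPoint_oppositeMidpoint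
    (hp : ∀ i, ‖p (i + 1) - p i‖ = 1) (i : ZMod 3) :
    IsSmoothPoint (convexHull ℝ (Set.range p)) (oppositeMidpoint p i) := by
  have hsup := isOutwardSupportVector_oppositeMidpoint hp i
  have hne := edge_add_ne_zero hp i
  have hsq := norm_edge_add_sq hp i
  obtain ⟨h1, h2⟩ := inner_edge_add hp i
  have hedge : p (i + 1) - p (i + 2) ≠ 0 := by
    have := hp (i + 1)
    rw [zmod_three_add_one_add_one, norm_sub_rev] at this
    rw [← norm_pos_iff, this]
    exact one_pos
  set w := (p (i + 1) - p i) + (p (i + 2) - p i) with hw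
  have hpos := norm_pos_iff.2 hne
  refine ⟨hsup.mem_frontier (oppositeMidpoint_mem p i) hne, ‖w‖⁻¹ • w,
    ⟨?_, hsup.smul (by positivity)⟩, ?_⟩
  · rw [norm_smul, norm_inv, norm_norm, inv_mul_cancel₀ hpos.ne']
  · rintro m ⟨hm1, hm⟩
    have hv := fun j => hm (p j) (subset_convexHull ℝ _ ⟨j, rfl⟩)
    have v0 := hv i
    have v1 := hv (i + 1)
    have v2 := hv (i + 2)
    rw [oppositeMidpoint_eq] at v0 v1 v2
    -- The midpoint is interior to its edge, so the inequalities at both endpoints force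
    -- orthogonality to the edge; the remaining vertex fixes the sign.
    have hvm : inner ℝ (p (i + 1) - p (i + 2)) m = 0 := by
      simp only [inner_sub_left, inner_smul_left, inner_add_left, RCLike.conj_to_real] at v1 v2 ⊢
      linarith
    have hvw : inner ℝ (p (i + 1) - p (i + 2)) w = 0 := by
      rw [← sub_sub_sub_cancel_right _ _ (p i), inner_sub_left, h1, h2, sub_self]
    have hwm : 0 ≤ inner ℝ w m := by
      rw [hw]
      simp only [inner_sub_left, inner_smul_left, inner_add_left, RCLike.conj_to_real] at v0 ⊢
      linarith
    have h := norm_sq_smul_eq_of_inner_eq_zero hedge hvw hvm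
    have hn := congrArg norm h
    rw [norm_smul, norm_smul, hm1, Real.norm_of_nonneg (by positivity), Real.norm_of_nonneg hwm,
      mul_one, sq] at hn
    have hn' : ‖w‖ = inner ℝ w m := mul_right_cancel₀ hpos.ne' hn
    rw [← hn', sq, mul_smul] at h
    exact ((inv_smul_eq_iff₀ hpos.ne').2 (smul_right_injective Plane hpos.ne' h).symm).symm

theorem isTable_convexHull_range (hT : (interior (convexHull ℝ (Set.range p))).Nonempty) :
    IsTable (convexHull ℝ (Set.range p)) :=
  ⟨(Set.finite_range p).isCompact_convexHull ℝ, convex_convexHull ℝ _, hT⟩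

/-- Here `s`, `t` and `s - t` are the differences of the heights of the vertices. If all were too
small, `t * (s - t)`, `s * (t - s)` would be negative and `s * t` positive, but the product of the
first two is `-(s * t) * (s - t) ^ 2`. -/
theorem three_quarters_le_sq {s t d : ℝ} (h : s ^ 2 - s * t + t ^ 2 = 3 / 4) (hs : s ^ 2 ≤ d ^ 2)
    (ht : t ^ 2 ≤ d ^ 2) (hst : (s - t) ^ 2 ≤ d ^ 2) : 3 / 4 ≤ d ^ 2 := by
  by_contra! hd
  have h1 : t * (s - t) < 0 := by linarith
  have h2 : s * (t - s) < 0 := by linarith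
  have h3 : 0 < s * t := by linarith
  have h4 := mul_pos_of_neg_of_neg h1 h2
  have h5 := mul_nonneg h3.le (sq_nonneg (s - t))
  linarith

theorem width_equilateral (hp : ∀ i, ‖p (i + 1) - p i‖ = 1) :
    width (convexHull ℝ (Set.range p)) = √3 / 2 := by
  have h3 : √3 ^ 2 = 3 := Real.sq_sqrt (by norm_num)
  have h3pos : 0 < √3 := Real.sqrt_pos.2 (by norm_num)
  have hn : (convexHull ℝ (Set.range p)).Nonempty := ⟨_, oppositeMidpoint_mem p 0⟩
  obtain ⟨e1, e2⟩ := inner_edge_add hp 0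
  have hsq := norm_edge_add_sq hp 0
  have hin := inner_eq_half hp 0
  have ha := hp 0
  have hb := hp 2
  rw [show (2 : ZMod 3) + 1 = 0 by decide, norm_sub_rev] at hb
  rw [zero_add, zero_add] at *
  set w := (p 1 - p 0) + (p 2 - p 0) with hw
  have hwn : ‖w‖ = √3 := by rw [← hsq, Real.sqrt_sq (norm_nonneg _)]
  have hband : ∃ u : Plane, ‖u‖ = 1 ∧ ∃ a : ℝ, ∀ x ∈ convexHull ℝ (Set.range p),
      a ≤ inner ℝ u x ∧ inner ℝ u x ≤ a + √3 / 2 := by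
    refine ⟨(√3)⁻¹ • w, ?_, inner ℝ ((√3)⁻¹ • w) (p 0), ?_⟩
    · rw [norm_smul, hwn, norm_inv, Real.norm_of_nonneg h3pos.le, inv_mul_cancel₀ h3pos.ne']
    · have hval : ∀ v, inner ℝ v w = 3 / 2 → inner ℝ ((√3)⁻¹ • w) v = √3 / 2 := by
        intro v hv
        rw [inner_smul_left, real_inner_comm, hv, RCLike.conj_to_real]
        field_simp
        linarith
      have f1 := hval _ e1
      have f2 := hval _ e2
      rw [inner_sub_right] at f1 f2
      set u := (√3)⁻¹ • w
      have hconv : Convex ℝ {x | inner ℝ u (p 0) ≤ inner ℝ u x ∧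
          inner ℝ u x ≤ inner ℝ u (p 0) + √3 / 2} :=
        (convex_halfSpace_ge (innerSL ℝ u).isBoundedLinearMap.toIsLinearMap _).inter
          (convex_halfSpace_le (innerSL ℝ u).isBoundedLinearMap.toIsLinearMap _)
      exact fun x hx => convexHull_range_subset hconv 0 ⟨le_rfl, by linarith⟩
        (show p 1 ∈ _ from ⟨by linarith, by linarith⟩)
        (show p 2 ∈ _ from ⟨by linarith, by linarith⟩) hx
  refine le_antisymm (csInf_le (bddBelow_bands _ hn) hband) (le_csInf ⟨_, hband⟩ ?_)
  rintro d ⟨u, hu, a, h⟩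
  -- For unit edges with inner product `1 / 2` and a unit vector `u`, this is `s ^ 2 - s * t + t ^ 2
  -- = 3 / 4`.
  have g := gram_identity (p 1 - p 0) (p 2 - p 0) u
  rw [hin, ha, hb, hu] at g
  have b := fun j => h (p j) (subset_convexHull ℝ _ ⟨j, rfl⟩)
  obtain ⟨b00, b01⟩ := b 0
  obtain ⟨b10, b11⟩ := b 1
  obtain ⟨b20, b21⟩ := b 2
  have hs : inner ℝ u (p 1 - p 0) = inner ℝ u (p 1) - inner ℝ u (p 0) := inner_sub_right _ _ _
  have ht : inner ℝ u (p 2 - p 0) = inner ℝ u (p 2) - inner ℝ u (p 0) := inner_sub_right _ _ _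
  have hd : 0 ≤ d := by linarith
  have hd2 : 3 / 4 ≤ d ^ 2 := by
    refine three_quarters_le_sq (s := inner ℝ u (p 1 - p 0)) (t := inner ℝ u (p 2 - p 0))
      (by linarith) (sq_le_sq' ?_ ?_) (sq_le_sq' ?_ ?_) (sq_le_sq' ?_ ?_) <;> linarith
  refine abs_le_of_sq_le_sq' ?_ hd |>.2
  rw [div_pow, h3]
  linarith

theorem cyclicSequence_oppositeMidpoint_mem
    (hp : ∀ i, ‖p (i + 1) - p i‖ = 1) :
    cyclicSequence (oppositeMidpoint p) ∈ regularBounceOrbits 3 (convexHull ℝ (Set.range p)) := by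
  refine ⟨cyclicSequence_mem_bounceOrbits (fun i => (isSmoothPoint_oppositeMidpoint hp i).1)
    (oppositeMidpoint_succ_ne hp) fun i => ?_, fun i => isSmoothPoint_oppositeMidpoint hp i⟩
  rw [triangleNormal_oppositeMidpoint hp]
  exact isOutwardSupportVector_oppositeMidpoint hp i

theorem length_cyclicSequence_oppositeMidpoint (hp : ∀ i, ‖p (i + 1) - p i‖ = 1) :
    length (cyclicSequence (oppositeMidpoint p)) = 3 / 2 := by
  rw [length_cyclicSequence (oppositeMidpoint_succ_ne hp), perimeter]
  simp only [norm_oppositeMidpoint_sub hp]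
  rw [sum_zmod_three _ 0]
  norm_num

theorem range_cyclicSequence (x : ZMod 3 → Plane) : Set.range (cyclicSequence x) = Set.range x :=
  (ZMod.intCast_surjective (n := 3)).range_comp x

end Equilateral

/-! ### Feet of the altitudes, and the final statement. -/

theorem altitudeFoot_eq_midpoint {D : Affine.Triangle ℝ Plane}
    (hD : ∀ i j : Fin 3, i ≠ j → dist (D.points i) (D.points j) = 1) {i j k : Fin 3}
    (hij : i ≠ j) (hik : i ≠ k) (hjk : j ≠ k) :
    D.altitudeFoot i = midpoint ℝ (D.points j) (D.points k) := by
  have hmem := D.altitudeFoot_mem_affineSpan_image_compl i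
  have hcompl : ({i}ᶜ : Set (Fin 3)) = {j, k} := by
    ext l
    simp only [Set.mem_compl_iff, Set.mem_singleton_iff, Set.mem_insert_iff]
    omega
  rw [hcompl, Set.image_pair, mem_affineSpan_pair_iff_exists_lineMap_eq] at hmem
  obtain ⟨r, hr⟩ := hmem
  have h1 : inner ℝ (D.points j -ᵥ D.altitudeFoot i) (D.points i -ᵥ D.altitudeFoot i) = 0 :=
    D.inner_vsub_altitudeFoot_vsub_altitudeFoot_eq_zero hij
  have h2 : inner ℝ (D.points k -ᵥ D.altitudeFoot i) (D.points i -ᵥ D.altitudeFoot i) = 0 :=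
    D.inner_vsub_altitudeFoot_vsub_altitudeFoot_eq_zero hik
  have d1 := hD i j hij
  have d2 := hD i k hik
  have d3 := hD j k hjk
  rw [← hr] at h1 h2 ⊢
  rw [dist_eq_norm] at d1 d2 d3
  rw [AffineMap.lineMap_apply_module'] at h1 h2 ⊢
  simp only [vsub_eq_sub] at h1 h2
  generalize D.points i = a at *
  generalize D.points j = b at *
  generalize D.points k = c at *
  have hbc := norm_sub_sq_real (a - b) (a - c)
  rw [sub_sub_sub_cancel_left, norm_sub_rev, d1, d2, d3] at hbc
  have e1 : b - (r • (c - b) + b) = r • ((a - c) - (a - b)) := by module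
  have e2 : c - (r • (c - b) + b) = (1 - r) • ((a - b) - (a - c)) := by module
  have e3 : a - (r • (c - b) + b) = (1 - r) • (a - b) + r • (a - c) := by module
  rw [e1, e3] at h1
  rw [e2, e3] at h2
  -- The orthogonality relations become `r * (r - 1 / 2) = 0` and `(1 - r) * (1 / 2 - r) = 0`; both
  -- are needed to exclude the endpoints.
  have hr2 : r = 1 / 2 := by
    generalize a - b = u at *
    generalize a - c = v at *
    simp only [inner_smul_left, inner_smul_right, inner_add_right, inner_sub_left,
      real_inner_self_eq_norm_sq, d1, d2, RCLike.conj_to_real, real_inner_comm u v] at h1 h2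
    nlinarith
  rw [hr2, midpoint_eq_smul_add, invOf_eq_inv]
  module

/-- The Fagnano orbit of an equilateral triangle of edge length one, and its width. -/
theorem fagnano (D : Affine.Triangle ℝ Plane)
    (hD : ∀ i j : Fin 3, i ≠ j → dist (D.points i) (D.points j) = 1) :
    (∃ c ∈ regularBounceOrbits 3 (convexHull ℝ (Set.range D.points)),
      Set.range c = Set.range D.altitudeFoot ∧ (∀ i : ℤ, dist (c i) (c (i + 1)) = 1 / 2) ∧
      length c = 3 / 2) ∧
    IsTable (convexHull ℝ (Set.range D.points)) ∧
    width (convexHull ℝ (Set.range D.points)) = √3 / 2 := by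
  -- `ZMod 3` unfolds to `Fin 3`, so the vertices can be read as a cyclic family.
  obtain ⟨p, hpD⟩ : ∃ p : ZMod 3 → Plane, p = D.points := ⟨_, rfl⟩
  have hp : ∀ i, ‖p (i + 1) - p i‖ = 1 := fun i => by
    rw [hpD, ← dist_eq_norm]
    exact hD _ _ (zmod_three_add_one_ne i)
  have hint : (interior (convexHull ℝ (Set.range p))).Nonempty := by
    rw [interior_convexHull_nonempty_iff_affineSpan_eq_top, hpD]
    exact D.independent.affineSpan_eq_top_iff_card_eq_finrank_add_one.2 (by simp)
  have hfoot : oppositeMidpoint p = D.altitudeFoot := funext fun i => by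
    rw [hpD]
    exact (altitudeFoot_eq_midpoint hD (zmod_three_add_one_ne i).symm
      (zmod_three_add_two_ne i).symm (zmod_three_add_two_ne_add_one i).symm).symm
  have hrange : Set.range D.points = Set.range p := hpD ▸ rfl
  rw [hrange]
  refine ⟨⟨_, cyclicSequence_oppositeMidpoint_mem hp, ?_, fun i => ?_,
    length_cyclicSequence_oppositeMidpoint hp⟩, isTable_convexHull_range hint,
    width_equilateral hp⟩
  · rw [range_cyclicSequence, hfoot]
    rfl
  · rw [dist_eq_norm', cyclicSequence, cyclicSequence, Int.cast_add, Int.cast_one]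
    exact norm_oppositeMidpoint_sub hp i

end Billiard

theorem mainTheorem7 :
    (∀ T : Set Plane, Billiard.IsTable T →
      ∀ c ∈ Billiard.bounceOrbits 3 T, Billiard.length c < 2 * Billiard.width T →
      ∀ T' : Set Plane, Billiard.IsTable T' →
      ∀ r₁ r₂ : ℝ, 0 < r₁ → 0 < r₂ → r₁ • T ⊆ T' → T' ⊆ r₂ • T →
        r₂ / r₁ < 2 * Billiard.width T / Billiard.length c →
        (Billiard.shortestOrbits T').Nonempty ∧
          Billiard.shortestOrbits T' ⊆ Billiard.regularBounceOrbits 3 T') ∧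
    (∀ D : Affine.Triangle ℝ Plane,
      (∀ i j : Fin 3, i ≠ j → dist (D.points i) (D.points j) = 1) →
      (∃ c ∈ Billiard.regularBounceOrbits 3 (convexHull ℝ (Set.range D.points)),
        Set.range c = Set.range D.altitudeFoot ∧
        (∀ i : ℤ, dist (c i) (c (i + 1)) = 1 / 2) ∧
        Billiard.length c = 3 / 2) ∧
      2 * Billiard.width (convexHull ℝ (Set.range D.points)) = √3 ∧
      (3 / 2 : ℝ) < √3 ∧
      ∀ T' : Set Plane, Billiard.IsTable T' →
      ∀ r₁ r₂ : ℝ, 0 < r₁ → 0 < r₂ →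
        r₁ • convexHull ℝ (Set.range D.points) ⊆ T' →
        T' ⊆ r₂ • convexHull ℝ (Set.range D.points) →
        r₂ / r₁ < 2 * √3 / 3 →
        (Billiard.shortestOrbits T').Nonempty ∧
          Billiard.shortestOrbits T' ⊆ Billiard.regularBounceOrbits 3 T') := by
  refine ⟨fun T hT c hc _ T' hT' r₁ r₂ h₁ h₂ hsub₁ hsub₂ hr =>
    Billiard.shortestOrbits_of_smul_subset hT hc hT' h₁ h₂ hsub₁ hsub₂ hr, fun D hD => ?_⟩
  obtain ⟨⟨c, hc, hfoot, hdist, hlen⟩, htable, hwidth⟩ := Billiard.fagnano D hD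
  refine ⟨⟨c, hc, hfoot, hdist, hlen⟩, ?_, ?_, fun T' hT' r₁ r₂ h₁ h₂ hsub₁ hsub₂ hr => ?_⟩
  · rw [hwidth]
    ring
  · rw [Real.lt_sqrt (by norm_num)]
    norm_num
  · refine Billiard.shortestOrbits_of_smul_subset htable hc.1 hT' h₁ h₂ hsub₁ hsub₂
      (hr.trans_eq ?_)
    rw [hwidth, hlen]
    ring
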